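/- Let $k$ be an infinite field, $R=k[x_1,\dots,x_d]$, $\mathfrak m=(x_1,\dots,x_d)$, and let $I\ne 0$ be an ideal of $R$ with a generating sequence $f_1,\dots,f_u$ consisting of monomials of the same degree $\delta$. Let $\mathcal F=\bigoplus_{n\ge 0}I^n/\mathfrak m I^n$ be the special fiber ring of $I$, let $\mathcal F_+$ be its ideal generated by the elements of positive degree, and let $\ell=\dim\mathcal F$ be the analytic spread of $I$. Let $\underline z=\{z_{ij}\mid 1\le i\le \ell,\ 1\le j\le u\}$ be variables and let $J\subseteq R[\underline z]=k[\underline z][x_1,\dots,x_d]$ be the ideal generated by $b_i=\sum_{j=1}^u z_{ij}f_j$, $1\le i\le \ell$. Let $\mathcal H\subseteq\mathcal F[\underline z]$ be the ideal generated by $\sum_{j=1}^u z_{ij}f_j$, $1\le i\le \ell$, where $f_j$ is regarded as an element of degree one of $\mathcal F$. For $\underline\lambda\in k^{\ell u}$ let $J_{\underline\lambda}\subseteq R$ be the image of $J$ under the evaluation $z_{ij}\mapsto\lambda_{ij}$. Let $\operatorname{mono}(J)$ be the ideal of $k[\underline z][x_1,\dots,x_d]$ generated by the elements of $J$ of the form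 $a\,m$ with $a\in k[\underline z]$ and $m$ a monomial in $x_1,\dots,x_d$. Then there are finitely many distinct vectors $\mathbf v_1,\dots,\mathbf v_r\in\mathbb N^d$ and ideals $C_1,\dots,C_r$ of $k[\underline z]$ with $$\operatorname{mono}(J)=C_1(\mathbf x^{\mathbf v_1})+\dots+C_r(\mathbf x^{\mathbf v_r}).\qquad(*)$$ Moreover, there is an irreducible polynomial $h\in k[\underline z]$ with $(\mathcal H:_{\mathcal F[\underline z]}\mathcal F_+^\infty)\cap k[\underline z]=(h)$; for every $\underline\lambda\in k^{\ell u}$ one has $h(\underline\lambda)=0$ if and only if $J_{\underline\lambda}$ is not a reduction of $I$ (a reduction of $I$ is an ideal $K\subseteq I$ with $I^{n+1}=KI^n$ for some $n\ge 0$); and for every decomposition $(*)$ the content ideal satisfies $$C_1+\dots+C_r=(h).$$ -/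

import Mathlib

open MvPolynomial

noncomputable section

/-- `J` is a reduction of `I`: a subideal with `I ^ (n + 1) = J * I ^ n` for some `n`
(equivalently, for all large `n`). -/
def IsIdealReduction {R : Type*} [CommRing R] (J I : Ideal R) : Prop :=
  J ≤ I ∧ ∃ n : ℕ, I ^ (n + 1) = J * I ^ n

/-- The saturation `K : L ^ ∞`, the union of the increasing chain of the ideals `K : L ^ n`. -/
def idealSaturation {S : Type*} [CommRing S] (K L : Ideal S) : Ideal S :=
  ⨆ n : ℕ, Submodule.colon K ((L ^ n : Ideal S) : Set S)

/-- For an ideal `L` of `A[x₁, …, x_d]`, the ideal generated by the elements of `L` of the form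
`a * m` with `a ∈ A` and `m` a monomial in `x₁, …, x_d`. -/
def monoIdeal {A : Type*} [CommRing A] {d : ℕ} (L : Ideal (MvPolynomial (Fin d) A)) :
    Ideal (MvPolynomial (Fin d) A) :=
  Ideal.span {p | p ∈ L ∧ ∃ (w : Fin d →₀ ℕ) (a : A), p = monomial w a}

section SpecialFiber

variable {k : Type*} [Field k] {d : ℕ}

/-- The homogeneous maximal ideal `𝔪 = (x₁, …, x_d)` of `k[x₁, …, x_d]`. -/
def homogMaxIdeal (k : Type*) [Field k] (d : ℕ) : Ideal (MvPolynomial (Fin d) k) :=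
  Ideal.span (Set.range X)

/-- The special fiber ring `⨁ₙ Iⁿ / 𝔪 Iⁿ`, as the quotient of the Rees algebra
`⨁ₙ Iⁿ tⁿ ⊆ R[t]` by the ideal generated by `𝔪`. -/
def SpecialFiberRing (I : Ideal (MvPolynomial (Fin d) k)) : Type _ :=
  reesAlgebra I ⧸ (homogMaxIdeal k d).map (algebraMap (MvPolynomial (Fin d) k) (reesAlgebra I))

instance (I : Ideal (MvPolynomial (Fin d) k)) : CommRing (SpecialFiberRing I) :=
  inferInstanceAs (CommRing (reesAlgebra I ⧸
    (homogMaxIdeal k d).map (algebraMap (MvPolynomial (Fin d) k) (reesAlgebra I))))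

instance (I : Ideal (MvPolynomial (Fin d) k)) : Algebra k (SpecialFiberRing I) :=
  inferInstanceAs (Algebra k (reesAlgebra I ⧸
    (homogMaxIdeal k d).map (algebraMap (MvPolynomial (Fin d) k) (reesAlgebra I))))

/-- The class in the special fiber ring of an element of the Rees algebra. -/
def specialFiberMk (I : Ideal (MvPolynomial (Fin d) k)) : reesAlgebra I →+* SpecialFiberRing I :=
  Ideal.Quotient.mk
    ((homogMaxIdeal k d).map (algebraMap (MvPolynomial (Fin d) k) (reesAlgebra I)))

/-- The analytic spread of `I`: the Krull dimension of the special fiber ring. -/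
def analyticSpread (I : Ideal (MvPolynomial (Fin d) k)) : WithBot ℕ∞ :=
  ringKrullDim (SpecialFiberRing I)

/-- The ideal of the special fiber ring generated by the (homogeneous) elements of positive
degree, which are the classes of the elements `c tⁿ` with `n > 0` and `c ∈ Iⁿ`. -/
def specialFiberPlus (I : Ideal (MvPolynomial (Fin d) k)) : Ideal (SpecialFiberRing I) :=
  Ideal.span {q | ∃ (p : reesAlgebra I) (n : ℕ) (c : MvPolynomial (Fin d) k),
    0 < n ∧ (p : Polynomial (MvPolynomial (Fin d) k)) = Polynomial.monomial n c ∧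
      q = specialFiberMk I p}

/-- An element `g` of `I`, seen in degree one of the special fiber ring: the class of `g t`. -/
def specialFiberOne (I : Ideal (MvPolynomial (Fin d) k)) (g : I) : SpecialFiberRing I :=
  specialFiberMk I ⟨Polynomial.monomial 1 (g : MvPolynomial (Fin d) k),
    reesAlgebra.monomial_mem.mpr (by simp)⟩

variable {u : ℕ} {I : Ideal (MvPolynomial (Fin d) k)}

/-- The ideal `J` of `k[z][x₁, …, x_d]` generated by the `ℓ` generic elements
`bᵢ = ∑ⱼ zᵢⱼ fⱼ` of `I`. -/
def genericIdeal (ℓ : ℕ) (f : Fin u → I) :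
    Ideal (MvPolynomial (Fin d) (MvPolynomial (Fin ℓ × Fin u) k)) :=
  Ideal.span (Set.range fun i : Fin ℓ =>
    ∑ j : Fin u, C (X (i, j)) * map C (f j : MvPolynomial (Fin d) k))

/-- The specialization `J_c` of `J` under `zᵢⱼ ↦ cᵢⱼ`, where `c` is a `k`-rational point:
the image of `J` under the (surjective) evaluation map. -/
def specializedIdeal (ℓ : ℕ) (f : Fin u → I) (c : Fin ℓ × Fin u → k) :
    Ideal (MvPolynomial (Fin d) k) :=
  (genericIdeal ℓ f).map (map (eval c))

/-- The ideal `𝓗` of `𝓕[z]` generated by the `ℓ` generic elements `∑ⱼ zᵢⱼ fⱼ`, where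
`𝓕` is the special fiber ring and `fⱼ` is placed in degree one of `𝓕`. -/
def genericFiberIdeal (ℓ : ℕ) (f : Fin u → I) :
    Ideal (MvPolynomial (Fin ℓ × Fin u) (SpecialFiberRing I)) :=
  Ideal.span (Set.range fun i : Fin ℓ => ∑ j : Fin u, X (i, j) * C (specialFiberOne I (f j)))

/-- The ideal `𝓐 = (𝓗 : 𝓕₊ ^ ∞) ∩ k[z]` of `k[z]`. -/
def nonReductionIdeal (ℓ : ℕ) (f : Fin u → I) : Ideal (MvPolynomial (Fin ℓ × Fin u) k) :=
  (idealSaturation (genericFiberIdeal ℓ f) ((specialFiberPlus I).map C)).comap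
    (map (algebraMap k (SpecialFiberRing I)))

end SpecialFiber

/-- `L = C₁ (x ^ v₁) + ⋯ + C_r (x ^ v_r)` with distinct exponent vectors `vᵢ` and ideals `Cᵢ`
of the coefficient ring. -/
def IsMonomialDecomposition {A : Type*} [CommRing A] {d r : ℕ}
    (L : Ideal (MvPolynomial (Fin d) A)) (v : Fin r → Fin d →₀ ℕ) (K : Fin r → Ideal A) : Prop :=
  Function.Injective v ∧ L = ⨆ i, (K i).map C * Ideal.span {monomial (v i) 1}

end

/-!
The ideal `(𝓗 : F₊ ^ ∞) ∩ k[z]` and the content ideal of `mono(J)` are shown to be one and the same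
kernel `P` of a ring homomorphism out of `k[z]`.

Since the `fⱼ` are homogeneous of one degree, the special fiber ring `F` is the subalgebra `k[f₁ t,
…, f_u t]` of `R[t]` (`exists_specialFiber_embedding`); in particular it is a domain. Let `K` be
the fraction field of `R`. In `K[z]` the elements `fⱼ` are units, so the equations `∑ⱼ zᵢⱼ fⱼ = 0`
can be solved for the variables of a column `j₀`; this defines the homomorphism `elimHom : k[z] →
K[z]`, with `z_{i j₀} ↦ -∑_{l ≠ j₀} z_{il} f_l / f_{j₀}`. Clearing denominators shows that `a` is
in its kernel if and only if some power of `T_{j₀} = f_{j₀} t` multiplies `a` into `𝓗`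
(`exists_pow_mul_mem_of_elimHom_eq_zero`, `elimHom_eq_zero_of_mul_mem`). As the second condition
implies that `a` is in the kernel for every other column, the kernel `P` does not depend on `j₀`,
and `P = (𝓗 : F₊ ^ ∞) ∩ k[z]` (`mem_nonReductionIdeal_iff`). If `a * x ^ w ∈ J`, then `a ∈ P`
because `x ^ w` is a unit in `K[z]`; conversely `Tⱼⁿ a ∈ 𝓗` gives `fⱼⁿ a ∈ J`, and `fⱼ` is a
monomial. So `P` is also the set of all coefficients `a` with some `a * x ^ w ∈ J`, which is the
content ideal of any decomposition of `mono(J)` (`IsMonomialDecomposition.iSup_eq`).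

The ideal `P` is prime, being the kernel of a homomorphism into a domain. It is nonzero by a count
of transcendence degrees (`exists_ne_zero_elimHom_eq_zero`). It contains no nonzero polynomial free
of a given `z_{i₀ j₀}`: such a polynomial would give a nonzero element in the kernel for the
remaining `ℓ - 1` rows, and a specialization at a point where that element does not vanish would
make `F` finite over an algebra generated by `ℓ - 1` elements (`trdeg_le_of_elimHom_eq_zero`). By
Gauss's lemma `P` is then generated by an irreducible polynomial `h` (`ker_elimHom_eq_span`).

Finally, if `h(c) ≠ 0`, specializing `Tⱼⁿ h ∈ 𝓗` at `c` gives `F_{n+1} = J_c F_n` for large `n`,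
hence `J_c` is a reduction. If `J_c` is a reduction, Nakayama's lemma over `k[z]` at the point `c`
provides an `a ∈ P` with `a(c) = 1` (`exists_eval_eq_one_of_pow_le`); as `h` divides `a`, `h(c) ≠
0`.
-/

/-! ### Krull dimension and transcendence degree -/

/-- Incomparability gives `≤`; lying over and going up, applied to a chain of primes, give `≥`. -/
theorem ringKrullDim_eq_of_isIntegral {A B : Type*} [CommRing A] [CommRing B] [Algebra A B]
    [Algebra.IsIntegral A B] (hinj : Function.Injective (algebraMap A B)) :
    ringKrullDim B = ringKrullDim A := by
  apply le_antisymm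
  · exact Order.krullDim_le_of_strictMono (PrimeSpectrum.comap (algebraMap A B)) fun p q h =>
      Ideal.IsIntegral.comap_lt_comap (R := A) h
  · refine iSup_le fun l => ?_
    obtain ⟨P, hP, hPl⟩ := Ideal.exists_ideal_over_prime_of_isIntegral (S := B)
      l.head.asIdeal ⊥ (by
        rw [← RingHom.ker_eq_comap_bot, (RingHom.injective_iff_ker_eq_bot _).mp hinj]
        exact bot_le)
    have := hPl.1
    have : P.LiesOver l.head.asIdeal := ⟨hPl.2.symm⟩
    obtain ⟨L, hL, -⟩ := Ideal.exists_ltSeries_of_hasGoingUp l P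
    rw [← hL]
    exact Order.LTSeries.length_le_krullDim L

/-- By Noether normalization, the Krull dimension of an affine domain is its transcendence degree.
-/
theorem trdeg_eq_of_ringKrullDim_eq (k : Type*) {A : Type*} [Field k] [CommRing A] [IsDomain A]
    [Algebra k A] [Algebra.FiniteType k A] {n : ℕ} (hn : ringKrullDim A = n) :
    Algebra.trdeg k A = n := by
  obtain ⟨s, g, hg, hint⟩ := exists_integral_inj_algHom_of_fg k A
  algebraize [g.toRingHom]
  have : IsScalarTower k (MvPolynomial (Fin s) k) A := IsScalarTower.of_algHom g
  have : Algebra.IsIntegral (MvPolynomial (Fin s) k) A := ⟨hint⟩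
  have hs : ringKrullDim A = s := by
    rw [ringKrullDim_eq_of_isIntegral (A := MvPolynomial (Fin s) k) (B := A) hg,
      MvPolynomial.ringKrullDim_of_isNoetherianRing]
    simp
  have hsn : s = n := by
    rw [hs] at hn
    exact_mod_cast hn
  have : FaithfulSMul (MvPolynomial (Fin s) k) A :=
    (faithfulSMul_iff_algebraMap_injective _ _).mpr hg
  have h := lift_trdeg_add_eq k (MvPolynomial (Fin s) k) A
  simp only [MvPolynomial.trdeg_of_isDomain, trdeg_eq_zero, Cardinal.mk_fin,
    Cardinal.lift_natCast, Cardinal.lift_zero, add_zero] at h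
  rw [← hsn]
  simpa using h.symm

/-! ### Kernels of polynomial rings in which one variable is algebraic -/

/-- If `D` embeds into `L`, the kernel of `D[Z] → L` is generated by any irreducible element `h`
that it contains: by Gauss's lemma `h` stays irreducible over the fraction field of `D`, and an
element of the kernel that `h` does not divide would be coprime to `h` there. -/
theorem Polynomial.ker_eq_span_of_irreducible {D L : Type*} [CommRing D] [IsDomain D]
    [UniqueFactorizationMonoid D] [Field L] (φ : Polynomial D →+* L)
    (hφ : Function.Injective (φ.comp Polynomial.C)) {h : Polynomial D} (hh : Irreducible h)
    (hker : φ h = 0) : RingHom.ker φ = Ideal.span {h} := by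
  let M := FractionRing D
  let ψ : M →+* L := IsFractionRing.lift (A := D) hφ
  have hψ (p : Polynomial D) :
      (p.map (algebraMap D M)).eval₂ ψ (φ Polynomial.X) = φ p := by
    rw [Polynomial.eval₂_map]
    have : ψ.comp (algebraMap D M) = φ.comp Polynomial.C := by
      ext x
      simp [ψ]
    rw [this]
    induction p using Polynomial.induction_on' with
    | add p q hp hq => simp [hp, hq]
    | monomial n a => simp [← Polynomial.C_mul_X_pow_eq_monomial]
  have hdeg : h.natDegree ≠ 0 := by
    intro h0
    obtain ⟨c, rfl⟩ := Polynomial.natDegree_eq_zero.mp h0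
    have : c = 0 := hφ (by simpa using hker)
    exact hh.ne_zero (by simp [this])
  have hprim : h.IsPrimitive := hh.isPrimitive hdeg
  have := Classical.arbitrary (NormalizedGCDMonoid D)
  have hirr : Irreducible (h.map (algebraMap D M)) :=
    hprim.irreducible_iff_irreducible_map_fraction_map.mp hh
  apply le_antisymm
  · intro p hp
    rw [Ideal.mem_span_singleton]
    rcases (dvd_or_isCoprime _ (p.map (algebraMap D M)) hirr) with hd | ⟨a, b, hab⟩
    · exact hprim.dvd_of_fraction_map_dvd_fraction_map hd
    · have := congrArg (Polynomial.eval₂ ψ (φ Polynomial.X)) hab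
      rw [Polynomial.eval₂_add, Polynomial.eval₂_mul, Polynomial.eval₂_mul, hψ, hψ, hker,
        show φ p = 0 from hp] at this
      simp at this
  · rw [Ideal.span_singleton_le_iff_mem]
    exact hker

/-- The same with a distinguished variable `s` in place of `Z`: it suffices that no nonzero
polynomial in the other variables lies in the kernel. -/
theorem MvPolynomial.ker_eq_span_of_irreducible {σ k L : Type*} [Field k] [Field L]
    (φ : MvPolynomial σ k →+* L) (s : σ)
    (hφ : ∀ p : MvPolynomial {x // x ≠ s} k, φ (rename Subtype.val p) = 0 → p = 0)
    {h : MvPolynomial σ k} (hh : Irreducible h) (hker : φ h = 0) :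
    RingHom.ker φ = Ideal.span {h} := by
  classical
  let e : MvPolynomial σ k ≃ₐ[k] Polynomial (MvPolynomial {x // x ≠ s} k) :=
    (renameEquiv k (Equiv.optionSubtypeNe s).symm).trans (optionEquivLeft k _)
  have he : (e.symm : _ →+* MvPolynomial σ k).comp Polynomial.C =
      (rename (Subtype.val : {x // x ≠ s} → σ) : _ →ₐ[k] _).toRingHom := by
    ext p
    · simp [e]
    · simp [e]
  have key := Polynomial.ker_eq_span_of_irreducible (φ.comp (e.symm : _ →+* MvPolynomial σ k))
    (h := e h) (by
      rw [RingHom.comp_assoc, he]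
      exact (injective_iff_map_eq_zero _).mpr hφ)
    ((MulEquiv.irreducible_iff e).mpr hh) (by simpa using hker)
  ext p
  have := SetLike.ext_iff.mp key (e p)
  simpa only [RingHom.mem_ker, RingHom.comp_apply, RingHom.coe_coe, AlgEquiv.symm_apply_apply,
    Ideal.mem_span_singleton, map_dvd_iff] using this

/-! ### Monomial decompositions -/

/-- By the Hilbert basis theorem finitely many `a * m` generate; for each exponent `v` that occurs,
take the ideal of all `a` with `a * x ^ v ∈ L`. -/
theorem exists_isMonomialDecomposition {A : Type*} [CommRing A] [IsNoetherianRing A] {d : ℕ}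
    (L : Ideal (MvPolynomial (Fin d) A)) :
    ∃ (r : ℕ) (v : Fin r → Fin d →₀ ℕ) (K : Fin r → Ideal A),
      IsMonomialDecomposition (monoIdeal L) v K := by
  classical
  obtain ⟨s, hs, hspan⟩ := (Submodule.fg_span_iff_fg_span_finset_subset
    {p | p ∈ L ∧ ∃ (w : Fin d →₀ ℕ) (a : A), p = monomial w a}).mp
      (IsNoetherian.noetherian (R := MvPolynomial (Fin d) A) (monoIdeal L))
  choose! w hw using fun p (hp : p ∈ s) => (hs hp).2
  let W := s.image w
  let K (v : Fin d →₀ ℕ) : Ideal A := (L.restrictScalars A).comap (monomial v)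
  refine ⟨W.card, fun i => W.equivFin.symm i, fun i => K (W.equivFin.symm i),
    Subtype.val_injective.comp W.equivFin.symm.injective, ?_⟩
  have hK {v : Fin d →₀ ℕ} {a : A} : a ∈ K v ↔ monomial v a ∈ L := by simp [K]
  apply le_antisymm
  · unfold monoIdeal Ideal.span
    rw [hspan, Submodule.span_le]
    intro p hp
    have hpW : w p ∈ W := Finset.mem_image_of_mem w hp
    obtain ⟨a, ha⟩ := hw p hp
    generalize w p = v at hpW ha
    subst ha
    have hle := le_iSup (fun i => (K (W.equivFin.symm i)).map C *
      Ideal.span {monomial (W.equivFin.symm i : Fin d →₀ ℕ) (1 : A)}) (W.equivFin ⟨v, hpW⟩)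
    apply hle
    have : (monomial v a : MvPolynomial (Fin d) A) = C a * monomial v 1 := by
      rw [C_mul_monomial, mul_one]
    simp only [Equiv.symm_apply_apply]
    rw [this]
    exact Ideal.mul_mem_mul (Ideal.mem_map_of_mem _ (hK.mpr (hs hp).1))
      (Ideal.mem_span_singleton_self _)
  · refine iSup_le fun i => ?_
    rw [Ideal.map, Ideal.span_mul_span', Ideal.span_le]
    rintro _ ⟨_, ⟨a, ha, rfl⟩, _, rfl, rfl⟩
    apply Ideal.subset_span
    simp only [C_mul_monomial, mul_one]
    exact ⟨hK.mp ha, _, a, rfl⟩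

/-- The content ideal does not depend on the decomposition: it consists of the coefficients `a` with
`a * x ^ w ∈ L` for some `w`. -/
theorem IsMonomialDecomposition.iSup_eq {A : Type*} [CommRing A] {d r : ℕ}
    {L : Ideal (MvPolynomial (Fin d) A)} {v : Fin r → Fin d →₀ ℕ} {K : Fin r → Ideal A}
    (hK : IsMonomialDecomposition (monoIdeal L) v K) {P : Ideal A}
    (hP : ∀ a, a ∈ P ↔ ∃ w : Fin d →₀ ℕ, monomial w a ∈ L) : ⨆ i, K i = P := by
  obtain ⟨-, hK⟩ := hK
  have hmono : monoIdeal L ≤ L := by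
    unfold monoIdeal
    rw [Ideal.span_le]
    exact fun p hp => hp.1
  apply le_antisymm
  · refine iSup_le fun i a ha => (hP a).mpr ⟨v i, hmono ?_⟩
    rw [hK]
    apply Ideal.mem_iSup_of_mem i
    have : (monomial (v i) a : MvPolynomial (Fin d) A) = C a * monomial (v i) 1 := by
      rw [C_mul_monomial, mul_one]
    rw [this]
    exact Ideal.mul_mem_mul (Ideal.mem_map_of_mem _ ha) (Ideal.mem_span_singleton_self _)
  · intro a ha
    obtain ⟨w, hw⟩ := (hP a).mp ha
    have h1 : monomial w a ∈ (⨆ i, K i).map (C (σ := Fin d)) := by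
      have : monoIdeal L ≤ (⨆ i, K i).map (C (σ := Fin d)) := by
        rw [hK]
        exact iSup_le fun i => Ideal.mul_le_left.trans (Ideal.map_mono (le_iSup K i))
      exact this (Ideal.subset_span ⟨hw, w, a, rfl⟩)
    simpa using mem_map_C_iff.mp h1 w

/-! ### The special fiber ring -/

section SpecialFiberRing

variable {k : Type*} [Field k] {d u : ℕ} {I : Ideal (MvPolynomial (Fin d) k)}

/-- The class of `c tⁿ` in the special fiber ring, for `c ∈ Iⁿ`. -/
noncomputable def specialFiberClass (n : ℕ) {c : MvPolynomial (Fin d) k} (hc : c ∈ I ^ n) :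
    SpecialFiberRing I :=
  specialFiberMk I ⟨Polynomial.monomial n c, reesAlgebra.monomial_mem.mpr hc⟩

theorem specialFiberMk_algebraMap (c : k) :
    specialFiberMk I (algebraMap k (reesAlgebra I) c) = algebraMap k (SpecialFiberRing I) c := rfl

theorem specialFiberMk_surjective : Function.Surjective (specialFiberMk I) :=
  Ideal.Quotient.mk_surjective

theorem specialFiberMk_eq_zero_iff {p : reesAlgebra I} : specialFiberMk I p = 0 ↔
    p ∈ (homogMaxIdeal k d).map (algebraMap (MvPolynomial (Fin d) k) (reesAlgebra I)) :=
  Ideal.Quotient.eq_zero_iff_mem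

theorem specialFiberClass_add {n : ℕ} {a b : MvPolynomial (Fin d) k} (ha : a ∈ I ^ n)
    (hb : b ∈ I ^ n) : specialFiberClass n (add_mem ha hb) =
      specialFiberClass n ha + specialFiberClass n hb := by
  unfold specialFiberClass
  rw [← map_add]
  congr 1
  ext1
  simp

theorem specialFiberClass_mul {m n : ℕ} {a b : MvPolynomial (Fin d) k} (ha : a ∈ I ^ m)
    (hb : b ∈ I ^ n) (hab : a * b ∈ I ^ (m + n)) : specialFiberClass (m + n) hab =
      specialFiberClass m ha * specialFiberClass n hb := by
  unfold specialFiberClass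
  rw [← map_mul]
  congr 1
  ext1
  simp [Polynomial.monomial_mul_monomial]

/-- In degree zero the special fiber ring is `R / 𝔪 = k`. -/
theorem specialFiberClass_zero_eq {c : MvPolynomial (Fin d) k} (hc : c ∈ I ^ 0) :
    specialFiberClass 0 hc = algebraMap k (SpecialFiberRing I) (constantCoeff c) := by
  rw [← specialFiberMk_algebraMap, ← sub_eq_zero]
  unfold specialFiberClass
  rw [← map_sub, specialFiberMk_eq_zero_iff]
  have h : c - C (constantCoeff c) ∈ homogMaxIdeal k d := by
    have := (mem_pow_idealOfVars_iff' 1 (c - C (constantCoeff c))).mpr fun x hx => by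
      obtain rfl : x = 0 := by simpa [Finsupp.degree_eq_zero_iff] using hx
      simp [constantCoeff_eq]
    rwa [pow_one] at this
  convert Ideal.mem_map_of_mem (algebraMap (MvPolynomial (Fin d) k) (reesAlgebra I)) h using 1
  ext1
  simp only [Polynomial.monomial_zero_left, AddSubgroupClass.coe_sub, map_sub]
  rfl

theorem specialFiberClass_smul {n : ℕ} (r : k) {a : MvPolynomial (Fin d) k} (ha : a ∈ I ^ n)
    (hra : C r * a ∈ I ^ n) : specialFiberClass n hra = r • specialFiberClass n ha := by
  have h0 : C r ∈ I ^ 0 := by simp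
  have h := specialFiberClass_zero_eq h0
  have h' := specialFiberClass_mul h0 ha (by rwa [zero_add])
  rw [h, constantCoeff_C, ← Algebra.smul_def] at h'
  rw [← h']
  unfold specialFiberClass
  simp only [zero_add]

variable (f : Fin u → I)

/-- The component `Iⁿ / 𝔪 Iⁿ` is spanned over `k` by the products of `n` of the generators. -/
theorem specialFiberClass_mem_pow
    (hgen : Ideal.span (Set.range fun j => (f j : MvPolynomial (Fin d) k)) = I) (n : ℕ)
    {c : MvPolynomial (Fin d) k} (hc : c ∈ I ^ n) :
    specialFiberClass n hc ∈
      Submodule.span k (Set.range fun j => specialFiberOne I (f j)) ^ n := by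
  set V := Submodule.span k (Set.range fun j => specialFiberOne I (f j))
  induction n generalizing c with
  | zero =>
    rw [specialFiberClass_zero_eq, pow_zero]
    exact Submodule.algebraMap_mem _
  | succ n ih =>
    suffices h : ∀ a ∈ I, ∀ b, b ∈ I ^ n → ∃ hab : a * b ∈ I ^ (n + 1),
        specialFiberClass (n + 1) hab ∈ V ^ (n + 1) by
      suffices ∃ hc' : c ∈ I ^ (n + 1), specialFiberClass (n + 1) hc' ∈ V ^ (n + 1) from this.2
      rw [pow_succ'] at hc
      induction hc using Submodule.mul_induction_on' with
      | mem_mul_mem a ha b hb => exact h a ha b hb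
      | add x hx y hy h1 h2 =>
        obtain ⟨h1, h1'⟩ := h1
        obtain ⟨h2, h2'⟩ := h2
        exact ⟨add_mem h1 h2, specialFiberClass_add h1 h2 ▸ add_mem h1' h2'⟩
    intro a ha
    rw [← hgen] at ha
    induction ha using Submodule.span_induction with
    | mem x hx =>
      obtain ⟨j, rfl⟩ := hx
      intro b hb
      have hfj : (f j : MvPolynomial (Fin d) k) ∈ I ^ 1 := by simp
      refine ⟨pow_succ' I n ▸ Ideal.mul_mem_mul (f j).2 hb, ?_⟩
      have key : ∀ (m : ℕ) (hm : 1 + n = m) (h : (f j : MvPolynomial (Fin d) k) * b ∈ I ^ m),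
          specialFiberClass m h = specialFiberClass 1 hfj * specialFiberClass n hb := by
        rintro m rfl h
        exact specialFiberClass_mul hfj hb h
      rw [key (n + 1) (add_comm _ _), pow_succ']
      exact Submodule.mul_mem_mul (Submodule.subset_span ⟨j, rfl⟩) (ih hb)
    | zero =>
      intro b hb
      have h0 : (0 : MvPolynomial (Fin d) k) ∈ I ^ (n + 1) := zero_mem _
      have : specialFiberClass (n + 1) h0 = 0 := by
        have := specialFiberClass_add h0 h0
        simpa using this
      simp only [zero_mul]
      exact ⟨h0, this ▸ zero_mem _⟩
    | add x y _ _ h1 h2 =>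
      intro b hb
      obtain ⟨h1, h1'⟩ := h1 b hb
      obtain ⟨h2, h2'⟩ := h2 b hb
      simp only [add_mul]
      exact ⟨add_mem h1 h2, specialFiberClass_add h1 h2 ▸ add_mem h1' h2'⟩
    | smul r x _ h =>
      intro b hb
      obtain ⟨h, h'⟩ := h (r * b) (Ideal.mul_mem_left _ _ hb)
      simp only [smul_eq_mul, mul_comm r x, mul_assoc]
      exact ⟨h, h'⟩

/-- Conversely, every `k`-combination of products of `n` generators is the class of some `c tⁿ`. -/
theorem exists_specialFiberClass_eq (n : ℕ) {x : SpecialFiberRing I}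
    (hx : x ∈ Submodule.span k (Set.range fun j => specialFiberOne I (f j)) ^ n) :
    ∃ (c : MvPolynomial (Fin d) k) (hc : c ∈ I ^ n), x = specialFiberClass n hc := by
  have hadd : ∀ (n : ℕ) (x y : SpecialFiberRing I),
      (∃ (c : MvPolynomial (Fin d) k) (hc : c ∈ I ^ n), x = specialFiberClass n hc) →
      (∃ (c : MvPolynomial (Fin d) k) (hc : c ∈ I ^ n), y = specialFiberClass n hc) →
      ∃ (c : MvPolynomial (Fin d) k) (hc : c ∈ I ^ n), x + y = specialFiberClass n hc := by
    rintro n _ _ ⟨a, ha, rfl⟩ ⟨b, hb, rfl⟩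
    exact ⟨a + b, add_mem ha hb, (specialFiberClass_add ha hb).symm⟩
  induction hx using Submodule.pow_induction_on_left' with
  | algebraMap r =>
    exact ⟨C r, by simp, by rw [specialFiberClass_zero_eq, constantCoeff_C]⟩
  | add x y n _ _ h1 h2 => exact hadd _ _ _ h1 h2
  | mem_mul m hm n x _ h =>
    obtain ⟨b, hb, rfl⟩ := h
    have hm' : ∃ (c : MvPolynomial (Fin d) k) (hc : c ∈ I ^ 1), m = specialFiberClass 1 hc := by
      induction hm using Submodule.span_induction with
      | mem x hx =>
        obtain ⟨j, rfl⟩ := hx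
        exact ⟨f j, by simp, rfl⟩
      | zero =>
        refine ⟨0, zero_mem _, ?_⟩
        have h0 : (0 : MvPolynomial (Fin d) k) ∈ I ^ 1 := zero_mem _
        have h := specialFiberClass_add h0 h0
        simp only [add_zero, left_eq_add] at h
        exact h.symm
      | add x y _ _ h1 h2 => exact hadd _ _ _ h1 h2
      | smul r x _ h =>
        obtain ⟨c, hc, rfl⟩ := h
        exact ⟨C r * c, Ideal.mul_mem_left _ _ hc, (specialFiberClass_smul r hc _).symm⟩
    obtain ⟨a, ha, rfl⟩ := hm'
    have key : ∀ (m : ℕ) (hm : 1 + n = m) (h : a * b ∈ I ^ m),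
        specialFiberClass m h = specialFiberClass 1 ha * specialFiberClass n hb := by
      rintro m rfl h
      exact specialFiberClass_mul ha hb h
    exact ⟨a * b, by
      rw [pow_succ']; exact Ideal.mul_mem_mul (by simpa using ha) hb, (key _ (add_comm _ _) _).symm⟩

theorem specialFiberMk_eq_sum (p : reesAlgebra I) : specialFiberMk I p =
    ∑ n ∈ (p : Polynomial (MvPolynomial (Fin d) k)).support, specialFiberClass n (p.2 n) := by
  unfold specialFiberClass
  rw [← map_sum]
  congr 1
  ext1
  rw [AddSubmonoidClass.coe_finsetSum]
  exact Polynomial.as_sum_support _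

theorem pow_span_le_adjoin {A : Type*} [CommRing A] [Algebra k A] (s : Set A) (n : ℕ) :
    Submodule.span k s ^ n ≤ Subalgebra.toSubmodule (Algebra.adjoin k s) := by
  induction n with
  | zero =>
    rw [pow_zero, Submodule.one_le]
    exact one_mem (Algebra.adjoin k s)
  | succ n ih =>
    have h1 : Submodule.span k s ≤ Subalgebra.toSubmodule (Algebra.adjoin k s) :=
      Submodule.span_le.mpr Algebra.subset_adjoin
    rw [pow_succ, Submodule.mul_le]
    exact fun x hx y hy => mul_mem (S := Subalgebra k A) (ih hx) (h1 hy)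

theorem adjoin_range_specialFiberOne
    (hgen : Ideal.span (Set.range fun j => (f j : MvPolynomial (Fin d) k)) = I) :
    Algebra.adjoin k (Set.range fun j => specialFiberOne I (f j)) = ⊤ := by
  rw [eq_top_iff]
  intro x _
  obtain ⟨p, rfl⟩ := specialFiberMk_surjective x
  rw [specialFiberMk_eq_sum]
  refine sum_mem fun n _ => ?_
  exact pow_span_le_adjoin _ n (specialFiberClass_mem_pow f hgen n (p.2 n))

theorem mem_pow_span_of_mem_pow {A ι : Type*} [CommRing A] [Algebra k A] (T : ι → A) (n : ℕ) {x : A}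
    (hx : x ∈ Submodule.span k (Set.range T) ^ n) : x ∈ Ideal.span (Set.range T) ^ n := by
  induction n generalizing x with
  | zero => simp
  | succ n ih =>
    rw [pow_succ] at hx ⊢
    induction hx using Submodule.mul_induction_on' with
    | mem_mul_mem a ha b hb =>
      exact Ideal.mul_mem_mul (ih ha) (Submodule.span_le_restrictScalars k A _ hb)
    | add x _ y _ h1 h2 => exact add_mem h1 h2

theorem specialFiberPlus_eq_span
    (hgen : Ideal.span (Set.range fun j => (f j : MvPolynomial (Fin d) k)) = I) :
    specialFiberPlus I = Ideal.span (Set.range fun j => specialFiberOne I (f j)) := by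
  unfold specialFiberPlus
  apply le_antisymm
  · rw [Ideal.span_le]
    rintro _ ⟨p, n, c, hn, hp, rfl⟩
    have hc : c ∈ I ^ n := by
      rw [← reesAlgebra.monomial_mem, ← hp]
      exact p.2
    have h := specialFiberClass_mem_pow f hgen n hc
    have hpc : specialFiberMk I p = specialFiberClass n hc := by
      unfold specialFiberClass
      congr 1
      ext1
      exact hp
    rw [hpc]
    exact Ideal.pow_le_self hn.ne' (mem_pow_span_of_mem_pow _ n h)
  · rw [Ideal.span_le]
    rintro _ ⟨j, rfl⟩
    exact Ideal.subset_span ⟨_, 1, f j, one_pos, rfl, rfl⟩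

theorem coeff_mem_of_specialFiberMk_eq_zero {p : reesAlgebra I} (hp : specialFiberMk I p = 0)
    (n : ℕ) : (p : Polynomial (MvPolynomial (Fin d) k)).coeff n ∈ homogMaxIdeal k d * I ^ n := by
  rw [specialFiberMk_eq_zero_iff, Ideal.map] at hp
  induction hp using Submodule.span_induction generalizing n with
  | mem x hx =>
    obtain ⟨a, ha, rfl⟩ := hx
    have : ((algebraMap (MvPolynomial (Fin d) k) (reesAlgebra I) a : reesAlgebra I) :
      Polynomial (MvPolynomial (Fin d) k)) = Polynomial.C a := rfl
    rw [this, Polynomial.coeff_C]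
    split_ifs with h
    · subst h
      simpa using ha
    · exact zero_mem _
  | zero => simp
  | add x y _ _ h1 h2 => simpa using add_mem (h1 n) (h2 n)
  | smul r x _ h =>
    rw [smul_eq_mul, MulMemClass.coe_mul, Polynomial.coeff_mul]
    refine sum_mem fun ij hij => ?_
    rw [← Finset.HasAntidiagonal.mem_antidiagonal.mp hij, pow_add, mul_left_comm]
    exact Ideal.mul_mem_mul (r.2 ij.1) (h ij.2)

/-- When the generators are homogeneous of one degree `δ`, the special fiber ring is the subalgebra
`k[f₁ t, …, f_u t]` of `R[t]`. Indeed, a polynomial in the `fⱼ t` has its coefficient of `tⁿ`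
homogeneous of degree `n δ`, whereas all monomials of elements of `𝔪 Iⁿ` have larger degree; so
a polynomial relation that holds modulo `𝔪` holds exactly. -/
theorem exists_specialFiber_embedding {δ : ℕ}
    (hgen : Ideal.span (Set.range fun j => (f j : MvPolynomial (Fin d) k)) = I)
    (hhom : ∀ j, (f j : MvPolynomial (Fin d) k).IsHomogeneous δ) :
    ∃ ε : SpecialFiberRing I →ₐ[k] Polynomial (MvPolynomial (Fin d) k),
      Function.Injective ε ∧ ∀ j, ε (specialFiberOne I (f j)) =
        Polynomial.C (f j : MvPolynomial (Fin d) k) * Polynomial.X := by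
  let γ : MvPolynomial (Fin u) k →ₐ[k] reesAlgebra I :=
    aeval fun j => ⟨Polynomial.monomial 1 (f j : MvPolynomial (Fin d) k),
      reesAlgebra.monomial_mem.mpr (by simp)⟩
  let mk : reesAlgebra I →ₐ[k] SpecialFiberRing I :=
    { specialFiberMk I with commutes' := fun _ => rfl }
  let ι : reesAlgebra I →ₐ[k] Polynomial (MvPolynomial (Fin d) k) :=
    (reesAlgebra I).val.restrictScalars k
  have hι : Function.Injective ι := Subtype.val_injective
  let α := mk.comp γ
  let β := ι.comp γ
  have hαX (j : Fin u) : α (X j) = specialFiberOne I (f j) := by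
    simp only [α, γ, AlgHom.comp_apply, aeval_X]
    rfl
  have hα : Function.Surjective α := by
    have h := adjoin_range_specialFiberOne f hgen
    rw [Algebra.adjoin_range_eq_range_aeval] at h
    rw [← AlgHom.range_eq_top, ← h]
    congr 1
    ext j
    simp [hαX]
  have hγ (q : MvPolynomial (Fin u) k) (n : ℕ) :
      ((γ q : Polynomial (MvPolynomial (Fin d) k)).coeff n).IsHomogeneous (n * δ) := by
    induction q using MvPolynomial.induction_on generalizing n with
    | C a =>
      have : (γ (C a) : Polynomial (MvPolynomial (Fin d) k)) = Polynomial.C (C a) := by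
        simp only [γ, aeval_C]
        rfl
      rw [this, Polynomial.coeff_C]
      split_ifs with h
      · subst h
        simpa using isHomogeneous_C (Fin d) a
      · exact isHomogeneous_zero _ _ _
    | add p q h1 h2 =>
      rw [map_add, AddMemClass.coe_add, Polynomial.coeff_add]
      exact (h1 n).add (h2 n)
    | mul_X p j h =>
      rw [map_mul, MulMemClass.coe_mul]
      have : (γ (X j) : Polynomial (MvPolynomial (Fin d) k)) =
          Polynomial.C (f j : MvPolynomial (Fin d) k) * Polynomial.X := by
        simp only [γ, aeval_X]
        rw [← Polynomial.monomial_one_one_eq_X, Polynomial.C_mul_monomial, mul_one]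
      rw [this, ← mul_assoc]
      cases n with
      | zero =>
        simpa using isHomogeneous_zero (Fin d) k 0
      | succ n =>
        rw [Polynomial.coeff_mul_X, Polynomial.coeff_mul_C, add_mul, one_mul]
        exact (h n).mul (hhom j)
  have hle : RingHom.ker α ≤ RingHom.ker β := by
    intro q hq
    have hq' : specialFiberMk I (γ q) = 0 := hq
    have hI : I ≤ idealOfVars (Fin d) k ^ δ := by
      rw [← hgen, Ideal.span_le]
      rintro _ ⟨j, rfl⟩
      exact (mem_pow_idealOfVars_iff' _ _).mpr fun x hx =>
        (hhom j).coeff_eq_zero (by omega)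
    suffices γ q = 0 by
      rw [RingHom.mem_ker, AlgHom.comp_apply, this, map_zero]
    ext1
    ext1 n
    have h1 := coeff_mem_of_specialFiberMk_eq_zero hq' n
    have h2 : homogMaxIdeal k d * I ^ n ≤ idealOfVars (Fin d) k ^ (n * δ + 1) := by
      rw [pow_succ', mul_comm n δ, pow_mul]
      exact Ideal.mul_mono le_rfl (Ideal.pow_right_mono hI n)
    have h3 := (mem_pow_idealOfVars_iff' _ _).mp (h2 h1)
    ext x
    by_cases hx : x.degree = n * δ
    · simpa using h3 x (by omega)
    · simpa using (hγ q n).coeff_eq_zero hx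
  let ε := AlgHom.liftOfSurjective α hα β hle
  have hε (q : MvPolynomial (Fin u) k) : ε (α q) = β q :=
    AlgHom.liftOfSurjective_apply α hα β hle q
  refine ⟨ε, ?_, ?_⟩
  · rw [injective_iff_map_eq_zero]
    intro x hx
    obtain ⟨q, rfl⟩ := hα x
    rw [hε] at hx
    have : γ q = 0 := hι (by simpa [β] using hx)
    simp [α, this]
  · intro j
    rw [← hαX, hε]
    simp only [β, γ, ι, AlgHom.comp_apply, aeval_X]
    simp [← Polynomial.C_mul_X_pow_eq_monomial]

end SpecialFiberRing

/-! ### Elimination of one column of variables -/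

section Elimination

variable {k ι κ : Type*} [Field k] [Fintype κ] [DecidableEq κ]

/-- The generic linear form `∑ⱼ zᵢⱼ Tⱼ` with the variables of row `i`. -/
noncomputable def rowForm {A : Type*} [CommRing A] (T : κ → A) (i : ι) : MvPolynomial (ι × κ) A :=
  ∑ j, X (i, j) * C (T j)

/-- The image of the variable `z_p` when, for every row `i ∈ S`, the variable `z_{i j₀}` is
replaced by `-∑_{l ≠ j₀} z_{il} y_l`, that is, by the solution of `∑ₗ z_{il} y_l = 0` for `y_{j₀} =
1`. The other variables are fixed; the value of `y` at `j₀` is irrelevant. -/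
noncomputable def elimValue {A : Type*} [CommRing A] (S : Set ι) (y : κ → A) (j₀ : κ) (p : ι × κ) :
    MvPolynomial (ι × κ) A :=
  open Classical in
  if p.1 ∈ S ∧ p.2 = j₀ then -∑ l ∈ Finset.univ.erase j₀, X (p.1, l) * C (y l) else X p

/-- The homomorphism `k[z] → A[z]` that eliminates the variables of column `j₀` in the rows of `S`.
-/
noncomputable def elimHom {A : Type*} [CommRing A] [Algebra k A] (S : Set ι) (y : κ → A) (j₀ : κ) :
    MvPolynomial (ι × κ) k →ₐ[k] MvPolynomial (ι × κ) A :=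
  aeval (elimValue S y j₀)

theorem map_elimValue {A B : Type*} [CommRing A] [CommRing B] (τ : A →+* B) (S : Set ι) (y : κ → A)
    (j₀ : κ) (p : ι × κ) : map τ (elimValue S y j₀ p) = elimValue S (τ ∘ y) j₀ p := by
  unfold elimValue
  split_ifs <;> simp

theorem map_elimHom {A B : Type*} [CommRing A] [CommRing B] [Algebra k A] [Algebra k B]
    (τ : A →ₐ[k] B) (S : Set ι) (y : κ → A) (j₀ : κ) (a : MvPolynomial (ι × κ) k) :
    map τ.toRingHom (elimHom S y j₀ a) = elimHom S (τ ∘ y) j₀ a := by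
  have h : (mapAlgHom τ).comp (elimHom S y j₀) = elimHom S (τ ∘ y) j₀ := by
    ext1 p
    simp only [elimHom, AlgHom.comp_apply, aeval_X]
    exact map_elimValue τ.toRingHom S y j₀ p
  exact DFunLike.congr_fun h a

variable {F K : Type*} [CommRing F] [Algebra k F] [Field K] [Algebra k K]
  {T : κ → F} {g : κ → K} {ε : F →ₐ[k] Polynomial K}

/-- Modulo the forms of the rows in `S`, a sufficiently high power of `T_{j₀}` clears the
denominators of the substitution `elimHom` with `y_l = T_l / T_{j₀}`; the fractions are seen
through `ε`. -/
theorem exists_pow_mul_sub_mem (hg : ∀ j, g j ≠ 0)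
    (hεT : ∀ j, ε (T j) = Polynomial.C (g j) * Polynomial.X) (S : Set ι) (j₀ : κ)
    (a : MvPolynomial (ι × κ) k) : ∃ (n : ℕ) (b : MvPolynomial (ι × κ) F),
      C (T j₀) ^ n * map (algebraMap k F) a - b ∈ Ideal.span (rowForm T '' S) ∧
      map ε.toRingHom b = C (ε (T j₀)) ^ n *
        map Polynomial.C (elimHom S (fun l => g l / g j₀) j₀ a) := by
  induction a using MvPolynomial.induction_on with
  | C c =>
    refine ⟨0, C (algebraMap k F c), by simp, ?_⟩
    simp only [map_C, pow_zero, one_mul]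
    rw [← algebraMap_eq (R := k), AlgHom.commutes]
    rw [IsScalarTower.algebraMap_apply k K (MvPolynomial (ι × κ) K)]
    simp [algebraMap_eq]
  | add p q hp hq =>
    obtain ⟨n₁, b₁, h₁, h₁'⟩ := hp
    obtain ⟨n₂, b₂, h₂, h₂'⟩ := hq
    refine ⟨n₁ + n₂, C (T j₀) ^ n₂ * b₁ + C (T j₀) ^ n₁ * b₂, ?_, ?_⟩
    · convert add_mem (Ideal.mul_mem_left _ (C (T j₀) ^ n₂) h₁)
        (Ideal.mul_mem_left _ (C (T j₀) ^ n₁) h₂) using 1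
      rw [map_add]
      ring
    · simp only [map_add, map_mul, map_pow, h₁', h₂', map_C]
      simp only [AlgHom.toRingHom_eq_coe, RingHom.coe_coe]
      ring
  | mul_X p q hp =>
    obtain ⟨n, b, h, h'⟩ := hp
    by_cases hq : q.1 ∈ S ∧ q.2 = j₀
    · obtain ⟨i, j⟩ := q
      obtain ⟨hi, rfl⟩ := hq
      have hsum := Finset.add_sum_erase Finset.univ
        (fun l => (X (i, l) * C (T l) : MvPolynomial (ι × κ) F)) (Finset.mem_univ j)
      refine ⟨n + 1, b * -∑ l ∈ Finset.univ.erase j, X (i, l) * C (T l), ?_, ?_⟩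
      · have hrow : rowForm T i ∈ Ideal.span (rowForm T '' S) :=
          Ideal.subset_span ⟨i, hi, rfl⟩
        convert add_mem (Ideal.mul_mem_left _ (C (T j) * X (i, j)) h)
          (Ideal.mul_mem_left _ b hrow) using 1
        rw [rowForm, ← hsum, map_mul, map_X]
        ring
      · have hX : elimHom S (fun l => g l / g j) j (X (i, j) : MvPolynomial (ι × κ) k) =
            -∑ l ∈ Finset.univ.erase j, X (i, l) * C (g l / g j) := by
          simp [elimHom, elimValue, hi]
        have hl (l : κ) : ε (T l) = ε (T j) * Polynomial.C (g l / g j) := by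
          rw [hεT, hεT, mul_right_comm, ← Polynomial.C_mul, mul_div_cancel₀ _ (hg j)]
        rw [map_mul, h', map_mul (elimHom _ _ _), hX, map_mul (map Polynomial.C)]
        simp only [map_neg, map_sum, map_mul, map_X, map_C]
        simp only [AlgHom.toRingHom_eq_coe, RingHom.coe_coe]
        have hsum' : ∑ l ∈ Finset.univ.erase j,
            (X (i, l) * C (ε (T l)) : MvPolynomial (ι × κ) (Polynomial K)) =
            C (ε (T j)) * ∑ l ∈ Finset.univ.erase j, X (i, l) * C (Polynomial.C (g l / g j)) := by
          rw [Finset.mul_sum]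
          refine Finset.sum_congr rfl fun l _ => ?_
          rw [hl l, C_mul]
          ring
        rw [hsum']
        ring
    · refine ⟨n, b * X q, ?_, ?_⟩
      · convert Ideal.mul_mem_right (X q) _ h using 1
        rw [map_mul, map_X]
        ring
      · have hX : elimHom S (fun l => g l / g j₀) j₀ (X q : MvPolynomial (ι × κ) k) = X q := by
          simp [elimHom, elimValue, hq]
        rw [map_mul, h', map_mul (elimHom _ _ _), hX]
        simp [mul_assoc]

theorem exists_pow_mul_mem_of_elimHom_eq_zero (hε : Function.Injective ε) (hg : ∀ j, g j ≠ 0)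
    (hεT : ∀ j, ε (T j) = Polynomial.C (g j) * Polynomial.X) {S : Set ι} {j₀ : κ}
    {a : MvPolynomial (ι × κ) k} (ha : elimHom S (fun l => g l / g j₀) j₀ a = 0) :
    ∃ n : ℕ, C (T j₀) ^ n * map (algebraMap k F) a ∈ Ideal.span (rowForm T '' S) := by
  obtain ⟨n, b, h, h'⟩ := exists_pow_mul_sub_mem hg hεT S j₀ a
  rw [ha, map_zero, mul_zero] at h'
  have : b = 0 := map_injective _ hε (by rw [h', map_zero])
  rw [this, sub_zero] at h
  exact ⟨n, h⟩

/-- The substitution kills the forms of the rows in `S`. -/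
theorem sum_elimValue_mul_eq_zero {A : Type*} [CommRing A] {S : Set ι} {i : ι} (hi : i ∈ S)
    {j₀ : κ} {y w : κ → A} (hw : ∀ l, w l = w j₀ * y l) :
    ∑ j, elimValue S y j₀ (i, j) * C (w j) = 0 := by
  have h1 : elimValue S y j₀ (i, j₀) = -∑ l ∈ Finset.univ.erase j₀, X (i, l) * C (y l) := by
    simp [elimValue, hi]
  have h2 (l : κ) (hl : l ∈ Finset.univ.erase j₀) : elimValue S y j₀ (i, l) * C (w l) =
      C (w j₀) * (X (i, l) * C (y l)) := by
    rw [hw l, C_mul]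
    simp only [elimValue, Finset.ne_of_mem_erase hl, and_false, if_false]
    ring
  rw [← Finset.add_sum_erase Finset.univ _ (Finset.mem_univ j₀), h1, Finset.sum_congr rfl h2,
    ← Finset.mul_sum]
  ring

/-- The kernel of `elimHom` contains every `a ∈ k[z]` that some nonzero element of `F` multiplies
into the ideal of the row forms, whichever column `j₀` is eliminated. -/
theorem elimHom_eq_zero_of_mul_mem (hε : Function.Injective ε) (hg : ∀ j, g j ≠ 0)
    (hεT : ∀ j, ε (T j) = Polynomial.C (g j) * Polynomial.X) {S : Set ι} {t : F} (ht : t ≠ 0)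
    {a : MvPolynomial (ι × κ) k}
    (ha : C t * map (algebraMap k F) a ∈ Ideal.span (rowForm T '' S)) (j₀ : κ) :
    elimHom S (fun l => g l / g j₀) j₀ a = 0 := by
  let Θ : MvPolynomial (ι × κ) F →+* MvPolynomial (ι × κ) (Polynomial K) :=
    eval₂Hom (C.comp ε.toRingHom) fun p => map Polynomial.C (elimValue S (fun l => g l / g j₀) j₀ p)
  have hΘ : (Θ.comp (map (algebraMap k F))) =
      (map Polynomial.C).comp (elimHom S (fun l => g l / g j₀) j₀ :
        MvPolynomial (ι × κ) k →ₐ[k] MvPolynomial (ι × κ) K).toRingHom := by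
    apply MvPolynomial.ringHom_ext
    · intro c
      simp only [Θ, RingHom.comp_apply, map_C, eval₂Hom_C]
      simp only [AlgHom.toRingHom_eq_coe, RingHom.coe_coe, AlgHom.commutes, ← algebraMap_eq (R := k)]
      rw [IsScalarTower.algebraMap_apply k K (MvPolynomial (ι × κ) K)]
      simp [algebraMap_eq]
    · intro p
      simp [Θ, elimHom]
  have hrow : Ideal.span (rowForm T '' S) ≤ RingHom.ker Θ := by
    rw [Ideal.span_le]
    rintro _ ⟨i, hi, rfl⟩
    have h := sum_elimValue_mul_eq_zero hi (j₀ := j₀) (y := Polynomial.C ∘ fun l => g l / g j₀)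
      (w := fun l => ε (T l)) fun l => by
        simp only [Function.comp_apply]
        rw [hεT, hεT, mul_right_comm, ← Polynomial.C_mul, mul_div_cancel₀ _ (hg j₀)]
    rw [SetLike.mem_coe, RingHom.mem_ker, rowForm, map_sum, ← h]
    exact Finset.sum_congr rfl fun j _ => by simp [Θ, map_elimValue]
  have h := hrow ha
  rw [RingHom.mem_ker, map_mul] at h
  have h' := DFunLike.congr_fun hΘ a
  simp only [RingHom.comp_apply] at h'
  rw [h'] at h
  rcases mul_eq_zero.mp h with h | h
  · refine absurd (hε ?_ : t = 0) ht
    simpa [Θ] using h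
  · exact map_injective _ Polynomial.C_injective (by simpa using h)

end Elimination

/-! ### Graded pieces and finiteness -/

section Graded

variable {k F K κ : Type*} [Field k] [CommRing F] [Algebra k F] [Field K] [Algebra k K]
  {T : κ → F} {g : κ → K} {ε : F →ₐ[k] Polynomial K}

/-- `F` is the sum of the subspaces `Vⁿ`, where `V` is spanned by the generators. -/
theorem iSup_span_pow_eq_top (hT : Algebra.adjoin k (Set.range T) = ⊤) :
    ⨆ n : ℕ, Submodule.span k (Set.range T) ^ n = ⊤ := by
  rw [eq_top_iff, ← Algebra.top_toSubmodule, ← hT, Algebra.adjoin_eq_span, Submodule.span_le]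
  intro x hx
  have : ∃ n : ℕ, x ∈ Submodule.span k (Set.range T) ^ n := by
    induction hx using Submonoid.closure_induction with
    | mem x hx => exact ⟨1, by rw [pow_one]; exact Submodule.subset_span hx⟩
    | one => exact ⟨0, by rw [pow_zero]; exact Submodule.one_le.mp le_rfl⟩
    | mul x y _ _ hx hy =>
      obtain ⟨m, hm⟩ := hx
      obtain ⟨n, hn⟩ := hy
      exact ⟨m + n, by rw [pow_add]; exact Submodule.mul_mem_mul hm hn⟩
  obtain ⟨n, hn⟩ := this
  exact Submodule.mem_iSup_of_mem n hn

theorem map_eq_monomial_of_mem_pow (hεT : ∀ j, ε (T j) = Polynomial.C (g j) * Polynomial.X) (n : ℕ)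
    {x : F} (hx : x ∈ Submodule.span k (Set.range T) ^ n) :
    ε x = Polynomial.monomial n ((ε x).coeff n) := by
  suffices ∃ c, ε x = Polynomial.monomial n c by
    obtain ⟨c, hc⟩ := this
    rw [hc, Polynomial.coeff_monomial_same]
  induction hx using Submodule.pow_induction_on_left' with
  | algebraMap r =>
    exact ⟨algebraMap k K r, by rw [AlgHom.commutes]; rfl⟩
  | add x y n _ _ h1 h2 =>
    obtain ⟨a, ha⟩ := h1
    obtain ⟨b, hb⟩ := h2
    exact ⟨a + b, by rw [map_add, map_add, ha, hb]⟩
  | mem_mul m hm n x _ h =>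
    obtain ⟨b, hb⟩ := h
    have hm' : ∃ a, ε m = Polynomial.monomial 1 a := by
      induction hm using Submodule.span_induction with
      | mem x hx =>
        obtain ⟨j, rfl⟩ := hx
        exact ⟨g j, by rw [hεT, Polynomial.C_mul_X_eq_monomial]⟩
      | zero => exact ⟨0, by simp⟩
      | add x y _ _ h1 h2 =>
        obtain ⟨a, ha⟩ := h1
        obtain ⟨b, hb⟩ := h2
        exact ⟨a + b, by rw [map_add, map_add, ha, hb]⟩
      | smul r x _ h =>
        obtain ⟨a, ha⟩ := h
        exact ⟨r • a, by rw [map_smul, ha, Polynomial.smul_monomial]⟩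
    obtain ⟨a, ha⟩ := hm'
    exact ⟨a * b, by rw [map_mul, ha, hb, Polynomial.monomial_mul_monomial, add_comm]⟩

/-- Every `x ∈ F` has a component of degree `n`, which lies in `Vⁿ`. -/
theorem exists_mem_pow_map_eq_monomial (hT : Algebra.adjoin k (Set.range T) = ⊤)
    (hεT : ∀ j, ε (T j) = Polynomial.C (g j) * Polynomial.X) (n : ℕ) (x : F) :
    ∃ y ∈ Submodule.span k (Set.range T) ^ n, ε y = Polynomial.monomial n ((ε x).coeff n) := by
  have hx : x ∈ ⨆ n : ℕ, Submodule.span k (Set.range T) ^ n := by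
    rw [iSup_span_pow_eq_top hT]
    trivial
  induction hx using Submodule.iSup_induction' with
  | mem m x hx =>
    by_cases h : m = n
    · subst h
      exact ⟨x, hx, map_eq_monomial_of_mem_pow hεT m hx⟩
    · refine ⟨0, zero_mem _, ?_⟩
      rw [map_eq_monomial_of_mem_pow hεT m hx, Polynomial.coeff_monomial, if_neg h]
      simp
  | zero => exact ⟨0, zero_mem _, by simp⟩
  | add x y _ _ hx hy =>
    obtain ⟨a, ha, ha'⟩ := hx
    obtain ⟨b, hb, hb'⟩ := hy
    exact ⟨a + b, add_mem ha hb, by simp [ha', hb']⟩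

/-- An element of degree `n + 1` of the ideal generated by a space `B` of linear forms is a
combination of elements of `B` with coefficients of degree `n`. -/
theorem mem_mul_pow_of_mem_span (hε : Function.Injective ε)
    (hT : Algebra.adjoin k (Set.range T) = ⊤)
    (hεT : ∀ j, ε (T j) = Polynomial.C (g j) * Polynomial.X) {B : Submodule k F}
    (hB : B ≤ Submodule.span k (Set.range T)) {n : ℕ} {x : F}
    (hx : x ∈ Submodule.span k (Set.range T) ^ (n + 1)) (hxB : x ∈ Ideal.span (B : Set F)) :
    x ∈ B * Submodule.span k (Set.range T) ^ n := by
  have key : ∀ r : F, ∃ y ∈ B * Submodule.span k (Set.range T) ^ n,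
      ε y = Polynomial.monomial (n + 1) ((ε (r * x)).coeff (n + 1)) := by
    clear hx
    induction hxB using Submodule.span_induction with
    | mem b hb =>
      intro r
      obtain ⟨y, hy, hy'⟩ := exists_mem_pow_map_eq_monomial hT hεT n r
      refine ⟨b * y, Submodule.mul_mem_mul hb hy, ?_⟩
      have hb' := map_eq_monomial_of_mem_pow hεT 1 (x := b) (by rw [pow_one]; exact hB hb)
      rw [map_mul, map_mul, hy', hb', Polynomial.monomial_mul_monomial, add_comm 1 n,
        ← Polynomial.C_mul_X_pow_eq_monomial (n := 1), pow_one, ← mul_assoc,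
        Polynomial.coeff_mul_X, Polynomial.coeff_mul_C, mul_comm]
    | zero => exact fun r => ⟨0, zero_mem _, by simp⟩
    | add x y _ _ hx hy =>
      intro r
      obtain ⟨a, ha, ha'⟩ := hx r
      obtain ⟨b, hb, hb'⟩ := hy r
      exact ⟨a + b, add_mem ha hb, by simp [ha', hb', mul_add]⟩
    | smul s x _ h =>
      intro r
      rw [smul_eq_mul, ← mul_assoc]
      exact h (r * s)
  obtain ⟨y, hy, hy'⟩ := key 1
  rw [one_mul, ← map_eq_monomial_of_mem_pow hεT (n + 1) hx] at hy'
  rwa [← hε hy']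

/-- If `V ^ (n + 1) ⊆ B Vⁿ`, the elements of degree at most `n` generate `F` as a `k[B]`-module. -/
theorem finite_adjoin_of_pow_le [Finite κ] (hT : Algebra.adjoin k (Set.range T) = ⊤) {s : Set F}
    {n : ℕ} (h : Submodule.span k (Set.range T) ^ (n + 1) ≤
      Submodule.span k s * Submodule.span k (Set.range T) ^ n) :
    Module.Finite (Algebra.adjoin k s) F := by
  set V := Submodule.span k (Set.range T)
  -- `(1 + V)ⁿ` contains all components of degree at most `n`.
  have hW : ((1 ⊔ V) ^ n).FG :=
    Submodule.FG.pow (Submodule.FG.sup ⟨{1}, by simp [Submodule.one_eq_span]⟩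
      (Submodule.fg_span (Set.finite_range T))) n
  obtain ⟨t, ht⟩ := hW
  let M : Submodule (Algebra.adjoin k s) F := Submodule.span _ (t : Set F)
  have hM : (1 ⊔ V) ^ n ≤ M.restrictScalars k := by
    rw [← ht, Submodule.span_le]
    exact Submodule.subset_span
  have hpow (m : ℕ) : V ^ (n + m) ≤ M.restrictScalars k := by
    induction m with
    | zero => exact (pow_le_pow_left' le_sup_right n).trans hM
    | succ m ih =>
      rw [← add_assoc, add_right_comm, pow_add]
      refine (mul_le_mul_left h _).trans ?_
      rw [mul_assoc, ← pow_add, Submodule.mul_le]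
      intro a ha b hb
      have ha' : a ∈ Algebra.adjoin k s :=
        (Submodule.span_le.mpr Algebra.subset_adjoin : Submodule.span k s ≤
          Subalgebra.toSubmodule (Algebra.adjoin k s)) ha
      exact M.smul_mem ⟨a, ha'⟩ (ih hb)
  have htop : M.restrictScalars k = ⊤ := by
    rw [eq_top_iff, ← iSup_span_pow_eq_top hT]
    refine iSup_le fun m => ?_
    rcases le_total m n with hmn | hmn
    · exact (pow_le_pow_left' le_sup_right m).trans ((pow_le_pow_right' le_sup_left hmn).trans hM)
    · obtain ⟨m, rfl⟩ := Nat.exists_eq_add_of_le hmn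
      exact hpow m
  exact ⟨⟨t, (Submodule.restrictScalars_eq_top_iff k _ _).mp htop⟩⟩

end Graded

section Specialization

variable {k F K ι κ : Type*} [Field k] [CommRing F] [Algebra k F] [Field K] [Algebra k K]
  [Fintype κ] [DecidableEq κ] {T : κ → F} {g : κ → K} {ε : F →ₐ[k] Polynomial K}

/-- The specialization `∑ⱼ cᵢⱼ Tⱼ` of the form of row `i` at the point `c`. -/
def specialRow (T : κ → F) (c : ι × κ → k) (i : ι) : F := ∑ j, c (i, j) • T j

/-- If `a` is in the kernel of the elimination for every column and `a(c) ≠ 0`, then specializing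
`z ↦ c` in `Tⱼⁿ a ∈ (∑ⱼ zᵢⱼ Tⱼ)` shows that the forms specialized at `c` generate an ideal that
contains a power of the irrelevant ideal. -/
theorem exists_pow_le_of_eval_ne_zero (hε : Function.Injective ε) (hg : ∀ j, g j ≠ 0)
    (hT : Algebra.adjoin k (Set.range T) = ⊤)
    (hεT : ∀ j, ε (T j) = Polynomial.C (g j) * Polynomial.X) {S : Set ι}
    {a : MvPolynomial (ι × κ) k} (ha : ∀ j, elimHom S (fun l => g l / g j) j a = 0)
    {c : ι × κ → k} (hc : eval c a ≠ 0) :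
    ∃ n : ℕ, Submodule.span k (Set.range T) ^ (n + 1) ≤
      Submodule.span k (specialRow T c '' S) * Submodule.span k (Set.range T) ^ n := by
  set V := Submodule.span k (Set.range T)
  let B := Submodule.span k (specialRow T c '' S)
  have hBV : B ≤ V := by
    rw [Submodule.span_le]
    rintro _ ⟨i, -, rfl⟩
    exact sum_mem fun j _ => V.smul_mem _ (Submodule.subset_span ⟨j, rfl⟩)
  let ev : MvPolynomial (ι × κ) F →+* F := eval fun p => algebraMap k F (c p)
  have hev : (Ideal.span (rowForm T '' S)).map ev ≤ Ideal.span (B : Set F) := by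
    rw [Ideal.map_span, Ideal.span_le]
    rintro _ ⟨_, ⟨i, hi, rfl⟩, rfl⟩
    refine Ideal.subset_span (Submodule.subset_span ⟨i, hi, ?_⟩)
    simp [specialRow, ev, rowForm, Algebra.smul_def]
  have hrad : Ideal.span (Set.range T) ≤ (Ideal.span (B : Set F)).radical := by
    rw [Ideal.span_le]
    rintro _ ⟨j, rfl⟩
    obtain ⟨n, hn⟩ := exists_pow_mul_mem_of_elimHom_eq_zero hε hg hεT (ha j)
    refine ⟨n, ?_⟩
    have h := hev (Ideal.mem_map_of_mem ev hn)
    have h' : ev (C (T j) ^ n * map (algebraMap k F) a) = T j ^ n * algebraMap k F (eval c a) := by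
      rw [map_mul, map_pow, eval_C, eval_map, ← Function.comp_def, eval₂_comp]
    rw [h'] at h
    exact (Ideal.mul_unit_mem_iff_mem _
      ((IsUnit.mk0 _ hc).map (algebraMap k F))).mp h
  obtain ⟨n, hn⟩ := Ideal.exists_pow_le_of_le_radical_of_fg hrad
    (Submodule.fg_span (Set.finite_range T))
  refine ⟨n, fun x hx => mem_mul_pow_of_mem_span hε hT hεT hBV hx (hn ?_)⟩
  exact Ideal.pow_le_pow_right n.le_succ (mem_pow_span_of_mem_pow T (n + 1) hx)

/-- The kernel of the elimination does not depend on the eliminated column. -/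
theorem elimHom_eq_zero_of_elimHom_eq_zero [IsDomain F] (hε : Function.Injective ε)
    (hg : ∀ j, g j ≠ 0) (hεT : ∀ j, ε (T j) = Polynomial.C (g j) * Polynomial.X) {S : Set ι}
    {j₀ : κ} {a : MvPolynomial (ι × κ) k} (ha : elimHom S (fun l => g l / g j₀) j₀ a = 0) (j : κ) :
    elimHom S (fun l => g l / g j) j a = 0 := by
  have hT0 : T j₀ ≠ 0 := by
    intro h
    have := hεT j₀
    rw [h, map_zero] at this
    exact hg j₀ (by simpa using this.symm)
  obtain ⟨n, hn⟩ := exists_pow_mul_mem_of_elimHom_eq_zero hε hg hεT ha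
  rw [← C_pow] at hn
  exact elimHom_eq_zero_of_mul_mem hε hg hεT (pow_ne_zero n hT0) hn j

/-- If the elimination in the rows of `S` is not injective, then `F` is finite over a subalgebra
generated by `#S` linear forms: specialize at a point where some element of the kernel does not
vanish. -/
theorem trdeg_le_of_elimHom_eq_zero [Infinite k] [IsDomain F] (hε : Function.Injective ε)
    (hg : ∀ j, g j ≠ 0) (hT : Algebra.adjoin k (Set.range T) = ⊤)
    (hεT : ∀ j, ε (T j) = Polynomial.C (g j) * Polynomial.X) {S : Finset ι} {j₀ : κ}
    {a : MvPolynomial (ι × κ) k} (ha0 : a ≠ 0)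
    (ha : elimHom (S : Set ι) (fun l => g l / g j₀) j₀ a = 0) : Algebra.trdeg k F ≤ S.card := by
  classical
  obtain ⟨c, hc⟩ : ∃ c, eval c a ≠ 0 := by
    by_contra! h
    exact ha0 (MvPolynomial.funext fun c => by rw [h c, map_zero])
  obtain ⟨n, hn⟩ := exists_pow_le_of_eval_ne_zero hε hg hT hεT
    (elimHom_eq_zero_of_elimHom_eq_zero hε hg hεT ha) hc
  have := finite_adjoin_of_pow_le hT hn
  have : Algebra.IsAlgebraic (Algebra.adjoin k (specialRow T c '' (S : Set ι))) F :=
    Algebra.IsIntegral.isAlgebraic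
  refine (Algebra.IsAlgebraic.trdeg_le_cardinalMk k (specialRow T c '' (S : Set ι))).trans ?_
  rw [← Finset.coe_image]
  exact Cardinal.mk_coe_finset.trans_le (by exact_mod_cast Finset.card_image_le)

omit [DecidableEq κ] in
/-- If the forms specialized at `c` generate everything in degree `n + 1`, then so do the generic
forms up to a polynomial `a` with `a(c) = 1`. This is Nakayama's lemma over `k[z]`, at the maximal
ideal of `c`, for the module generated by `V ^ (n + 1)` modulo the row forms. -/
theorem exists_eval_eq_one_of_pow_le {n : ℕ} {c : ι × κ → k}
    (h : ∀ x ∈ Submodule.span k (Set.range T) ^ (n + 1),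
      x ∈ Submodule.span k (Set.range (specialRow T c)) * Submodule.span k (Set.range T) ^ n) :
    ∃ a : MvPolynomial (ι × κ) k, eval c a = 1 ∧
      ∀ x ∈ Submodule.span k (Set.range T) ^ (n + 1),
        C x * map (algebraMap k F) a ∈ Ideal.span (Set.range (rowForm (ι := ι) T)) := by
  set V := Submodule.span k (Set.range T)
  -- The coefficientwise action of `k[z]` on `F[z]`.
  let alg : Algebra (MvPolynomial (ι × κ) k) (MvPolynomial (ι × κ) F) :=
    (map (algebraMap k F)).toAlgebra
  let H : Submodule (MvPolynomial (ι × κ) k) (MvPolynomial (ι × κ) F) :=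
    (Ideal.span (Set.range (rowForm (ι := ι) T))).restrictScalars _
  have hsmul (a : MvPolynomial (ι × κ) k) (b : MvPolynomial (ι × κ) F) :
      a • b = map (algebraMap k F) a * b := rfl
  let N : Submodule (MvPolynomial (ι × κ) k) (MvPolynomial (ι × κ) F) :=
    Submodule.span _ (C '' ((V ^ (n + 1) : Submodule k F) : Set F))
  have hN : N.FG := by
    obtain ⟨t, ht⟩ := Submodule.FG.pow (Submodule.fg_span (R := k) (Set.finite_range T)) (n + 1)
    refine Submodule.fg_def.mpr ⟨C '' (t : Set F), t.finite_toSet.image _, ?_⟩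
    apply le_antisymm
    · refine Submodule.span_mono (Set.image_mono ?_)
      rw [← ht]
      exact Submodule.subset_span
    · refine Submodule.span_le.mpr ?_
      rintro _ ⟨x, hx, rfl⟩
      rw [← ht] at hx
      induction hx using Submodule.span_induction with
      | mem x hx => exact Submodule.subset_span ⟨x, hx, rfl⟩
      | zero => simp
      | add x y _ _ h1 h2 =>
        rw [map_add]
        exact add_mem h1 h2
      | smul r x _ h =>
        have : (C (r • x) : MvPolynomial (ι × κ) F) =
            (C r : MvPolynomial (ι × κ) k) • C x := by
          rw [hsmul, map_C, ← C_mul, Algebra.smul_def]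
        rw [this]
        exact Submodule.smul_mem _ _ h
  have hle : N ≤ H ⊔ RingHom.ker (eval c) • N := by
    refine Submodule.span_le.mpr ?_
    rintro _ ⟨x, hx, rfl⟩
    have hx' := h x hx
    clear hx
    induction hx' using Submodule.mul_induction_on' with
    | mem_mul_mem b hb v hv =>
      induction hb using Submodule.span_induction with
      | mem b hb =>
        obtain ⟨i, rfl⟩ := hb
        have : (C (specialRow T c i * v) : MvPolynomial (ι × κ) F) = C v * rowForm T i +
            ∑ j, (C (c (i, j)) - X (i, j) : MvPolynomial (ι × κ) k) • C (T j * v) := by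
          simp only [hsmul, map_sub, map_C, map_X, specialRow, rowForm, Finset.mul_sum,
            ← Finset.sum_add_distrib, map_mul, Finset.sum_mul, map_sum, Algebra.smul_def]
          exact Finset.sum_congr rfl fun j _ => by ring
        rw [this]
        refine add_mem (Submodule.mem_sup_left ?_) (Submodule.mem_sup_right ?_)
        · exact Ideal.mul_mem_left _ _ (Ideal.subset_span ⟨i, rfl⟩)
        · refine sum_mem fun j _ => Submodule.smul_mem_smul (by simp [RingHom.mem_ker]) ?_
          refine Submodule.subset_span ⟨_, ?_, rfl⟩
          rw [pow_succ']
          exact Submodule.mul_mem_mul (Submodule.subset_span ⟨j, rfl⟩) hv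
      | zero => simp
      | add x y _ _ h1 h2 =>
        rw [add_mul, map_add]
        exact add_mem h1 h2
      | smul r x _ h =>
        have : (C (r • x * v) : MvPolynomial (ι × κ) F) =
            (C r : MvPolynomial (ι × κ) k) • C (x * v) := by
          rw [hsmul, map_C, ← C_mul, Algebra.smul_def, mul_assoc]
        rw [this]
        exact Submodule.smul_mem _ _ h
    | add x _ y _ h1 h2 =>
      rw [map_add]
      exact add_mem h1 h2
  obtain ⟨a, ha, haN⟩ := Submodule.exists_sub_one_mem_and_smul_le_of_fg_of_le_sup hN le_rfl hle
  refine ⟨a, ?_, fun x hx => ?_⟩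
  · rw [RingHom.mem_ker, map_sub, map_one, sub_eq_zero] at ha
    exact ha
  · have hxN : (C x : MvPolynomial (ι × κ) F) ∈ N := Submodule.subset_span ⟨x, hx, rfl⟩
    have := haN (Submodule.smul_mem_pointwise_smul _ a _ hxN)
    rw [hsmul, mul_comm] at this
    exact this

end Specialization

/-! ### Nontriviality of the elimination ideal -/

section Nonvanishing

/-- The column `j₀` no longer occurs after the elimination, so it can be dropped from the
variables. -/
theorem rename_retract_elimHom {k A ι κ : Type*} [Field k] [Fintype κ] [DecidableEq κ]
    [CommRing A] [Algebra k A] (y : κ → A) (j₀ : κ) (a : MvPolynomial (ι × κ) k) :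
    rename (Prod.map id Subtype.val)
      (aeval (R := A) (fun p : ι × κ => if h : p.2 ≠ j₀ then
        (X (p.1, ⟨p.2, h⟩) : MvPolynomial (ι × {j // j ≠ j₀}) A) else 0)
        (elimHom Set.univ y j₀ a)) = elimHom Set.univ y j₀ a := by
  let inc : MvPolynomial (ι × {j // j ≠ j₀}) A →ₐ[A] MvPolynomial (ι × κ) A :=
    rename (Prod.map id Subtype.val)
  let ret : MvPolynomial (ι × κ) A →ₐ[A] MvPolynomial (ι × {j // j ≠ j₀}) A :=
    aeval fun p => if h : p.2 ≠ j₀ then X (p.1, ⟨p.2, h⟩) else 0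
  have hX (i : ι) (l : κ) (hl : l ≠ j₀) : inc (ret (X (i, l))) = X (i, l) := by
    simp [inc, ret, hl]
  have hC (x : A) : inc (ret (C x)) = C x := by
    simp [inc, ret, algebraMap_eq]
  change inc (ret _) = _
  have : ((inc.comp ret).restrictScalars k).comp (elimHom Set.univ y j₀) =
      elimHom Set.univ y j₀ := by
    ext1 p
    simp only [elimHom, AlgHom.comp_apply, aeval_X, AlgHom.restrictScalars_apply]
    obtain ⟨i, j⟩ := p
    by_cases hj : j = j₀
    · simp only [elimValue, Set.mem_univ, true_and, hj, if_true, map_neg, map_sum, map_mul]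
      congr 1
      refine Finset.sum_congr rfl fun l hl => ?_
      rw [hX i l (Finset.ne_of_mem_erase hl), hC]
    · simp only [elimValue, Set.mem_univ, true_and, hj, if_false]
      exact hX i j hj
  exact DFunLike.congr_fun this a

/-- A count of transcendence degrees. -/
theorem exists_ne_zero_eval₂_eq_zero {k M σ τ : Type*} [Field k] [Field M] [Algebra k M]
    [Fintype σ] [Fintype τ] {n : ℕ} (hM : Algebra.trdeg k M = n)
    (hcard : n + Fintype.card τ < Fintype.card σ + 1)
    (ψ : MvPolynomial σ k →ₐ[k] MvPolynomial τ M) (t : MvPolynomial τ M) :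
    ∃ Q : Polynomial (MvPolynomial σ k), Q ≠ 0 ∧ Q.eval₂ ψ.toRingHom t = 0 := by
  let Ψ : Polynomial (MvPolynomial σ k) →ₐ[k] MvPolynomial τ M :=
    Polynomial.eval₂AlgHom ψ t fun _ => Commute.all _ _
  have hninj : ¬ Function.Injective Ψ := by
    intro hinj
    have h1 := lift_trdeg_le_of_injective (Ψ.comp (optionEquivLeft k σ).toAlgHom)
      (hinj.comp (optionEquivLeft k σ).injective)
    have h2 := lift_trdeg_add_eq k M (MvPolynomial τ M)
    rw [hM, MvPolynomial.trdeg_of_isDomain] at h2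
    rw [MvPolynomial.trdeg_of_isDomain] at h1
    simp only [Cardinal.mk_fintype, Cardinal.lift_natCast, Fintype.card_option] at h1 h2
    have h3 : Algebra.trdeg k (MvPolynomial τ M) = ((n + Fintype.card τ : ℕ) : Cardinal) := by
      apply Cardinal.lift_injective
      rw [← h2]
      simp
    rw [h3, Cardinal.lift_natCast, Nat.cast_le] at h1
    omega
  rw [injective_iff_map_eq_zero] at hninj
  push Not at hninj
  obtain ⟨Q, hQ, hQ0⟩ := hninj
  exact ⟨Q, hQ0, hQ⟩

/-- `c X` is transcendental over `K[z]`. -/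
theorem eq_zero_of_sum_map_C_mul_pow_eq_zero {K σ : Type*} [Field K] {s : Finset ℕ}
    (p : ℕ → MvPolynomial σ K) {c : K} (hc : c ≠ 0)
    (h : ∑ n ∈ s, map Polynomial.C (p n) * C (Polynomial.C c * Polynomial.X) ^ n = 0) {m : ℕ}
    (hm : m ∈ s) : p m = 0 := by
  ext v
  have h := congrArg (fun p => (coeff v p).coeff m) h
  simp only [← C_pow, mul_comm _ (C _), mul_pow, coeff_sum, coeff_C_mul, coeff_map, Polynomial.finsetSum_coeff,
    coeff_zero, Polynomial.coeff_zero] at h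
  rw [Finset.sum_eq_single m] at h
  · rw [Polynomial.coeff_mul_C, ← Polynomial.C_pow, Polynomial.coeff_C_mul_X_pow, if_pos rfl] at h
    simpa [hc] using h
  · intro n _ hn
    rw [Polynomial.coeff_mul_C, ← Polynomial.C_pow, Polynomial.coeff_C_mul_X_pow,
      if_neg (Ne.symm hn), zero_mul]
  · exact fun h0 => absurd hm h0

/-- For as many rows as the transcendence degree `ℓ` of `F`, the elimination has a nontrivial
kernel. Adjoin a variable `τ ↦ T_{j₀}` to `k[z]` and map to `Frac(F)[z']`, where `z'` consists of
the `ℓ (u - 1)` variables outside column `j₀`. The source has transcendence degree `ℓ u + 1`, the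
target `ℓ u`, so there is a relation `∑ qₙ τⁿ`; since `T_{j₀} = g_{j₀} X` is transcendental over
the fractions `T_l / T_{j₀} = g_l / g_{j₀}`, every `qₙ` lies in the kernel. -/
theorem exists_ne_zero_elimHom_eq_zero {k F K ι κ : Type*} [Field k] [CommRing F] [IsDomain F]
    [Algebra k F] [Field K] [Algebra k K] [Fintype ι] [Fintype κ] [DecidableEq κ]
    {T : κ → F} {g : κ → K} {ε : F →ₐ[k] Polynomial K}
    (hε : Function.Injective ε) (hg : ∀ j, g j ≠ 0)
    (hεT : ∀ j, ε (T j) = Polynomial.C (g j) * Polynomial.X) (j₀ : κ)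
    (htr : Algebra.trdeg k F = Fintype.card ι) :
    ∃ a : MvPolynomial (ι × κ) k, a ≠ 0 ∧ elimHom Set.univ (fun l => g l / g j₀) j₀ a = 0 := by
  -- The fraction fields are made opaque, which keeps instance unification cheap.
  obtain ⟨M, _, _, _, _, _, hMF⟩ : ∃ (M : Type _) (_ : Field M) (_ : Algebra F M) (_ : Algebra k M)
      (_ : IsScalarTower k F M) (_ : IsFractionRing F M), Algebra.IsAlgebraic F M :=
    ⟨FractionRing F, inferInstance, inferInstance, inferInstance, inferInstance, inferInstance,
      IsFractionRing.comap_isAlgebraic_iff.mpr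
        (inferInstance : Algebra.IsAlgebraic (FractionRing F) (FractionRing F))⟩
  obtain ⟨E, _, _, _, _, hEK⟩ : ∃ (E : Type _) (_ : Field E) (_ : Algebra (Polynomial K) E)
      (_ : Algebra k E) (_ : IsScalarTower k (Polynomial K) E), IsFractionRing (Polynomial K) E :=
    ⟨FractionRing (Polynomial K), inferInstance, inferInstance, inferInstance, inferInstance,
      inferInstance⟩
  let T' : κ → M := fun l => algebraMap F M (T l)
  let y : κ → M := fun l => T' l / T' j₀
  let ψ : MvPolynomial (ι × κ) k →ₐ[k] MvPolynomial (ι × {j // j ≠ j₀}) M :=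
    ((aeval (R := M) (fun p : ι × κ => if h : p.2 ≠ j₀ then
        (X (p.1, ⟨p.2, h⟩) : MvPolynomial (ι × {j // j ≠ j₀}) M) else 0)).restrictScalars k).comp
      (elimHom Set.univ y j₀)
  have htrM : Algebra.trdeg k M = Fintype.card ι := by
    have : FaithfulSMul F M := inferInstance
    have : FaithfulSMul k F := inferInstance
    rw [← trdeg_add_eq k F (A := M), trdeg_eq_zero (R := F), add_zero, htr]
  have hcard : Fintype.card ι + Fintype.card (ι × {j // j ≠ j₀}) < Fintype.card (ι × κ) + 1 := by
    have h0 : 0 < Fintype.card κ := Fintype.card_pos_iff.mpr ⟨j₀⟩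
    have h1 : Fintype.card {j // j ≠ j₀} + 1 = Fintype.card κ := by
      simp only [ne_eq, Fintype.card_subtype_compl, Fintype.card_unique]
      omega
    rw [Fintype.card_prod, Fintype.card_prod, ← h1]
    linarith
  obtain ⟨Q, hQ0, hQ⟩ := exists_ne_zero_eval₂_eq_zero htrM hcard ψ (C (T' j₀))
  obtain ⟨m, hm⟩ : ∃ m, Q.coeff m ≠ 0 := by
    by_contra! h
    exact hQ0 (Polynomial.ext h)
  refine ⟨Q.coeff m, hm, ?_⟩
  have hinj : Function.Injective ((IsScalarTower.toAlgHom k (Polynomial K) E).comp ε) :=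
    (IsFractionRing.injective (Polynomial K) E).comp hε
  let η : M →ₐ[k] E := IsFractionRing.liftAlgHom hinj
  have hηT (l : κ) : η (T' l) = algebraMap (Polynomial K) E (ε (T l)) := by
    exact IsFractionRing.lift_algebraMap hinj _
  have hη (a : MvPolynomial (ι × κ) k) :
      map η.toRingHom (rename (Prod.map id Subtype.val) (ψ a)) =
      map (algebraMap (Polynomial K) E) (map Polynomial.C
        (elimHom Set.univ (fun l => g l / g j₀) j₀ a)) := by
    have h1 : rename (Prod.map id Subtype.val) (ψ a) = elimHom Set.univ y j₀ a :=
      rename_retract_elimHom y j₀ a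
    have h := map_elimHom ((IsScalarTower.toAlgHom k (Polynomial K) E).comp
      (Polynomial.CAlgHom (R := k) (A := K))) Set.univ (fun l => g l / g j₀) j₀ a
    rw [h1, map_elimHom, map_map]
    refine Eq.trans ?_ h.symm
    congr 2
    funext l
    have hX : algebraMap (Polynomial K) E Polynomial.X ≠ 0 := by
      rw [Ne, map_eq_zero_iff _ (IsFractionRing.injective (Polynomial K) E)]
      exact Polynomial.X_ne_zero
    have hgj : algebraMap (Polynomial K) E (Polynomial.C (g j₀)) ≠ 0 := by
      rw [Ne, map_eq_zero_iff _ (IsFractionRing.injective (Polynomial K) E)]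
      exact Polynomial.C_ne_zero.mpr (hg j₀)
    have hgl : algebraMap (Polynomial K) E (Polynomial.C (g l / g j₀)) =
        algebraMap (Polynomial K) E (Polynomial.C (g l)) /
          algebraMap (Polynomial K) E (Polynomial.C (g j₀)) := by
      rw [eq_div_iff hgj, ← map_mul, ← Polynomial.C_mul, div_mul_cancel₀ _ (hg j₀)]
    change η (T' l / T' j₀) = algebraMap (Polynomial K) E (Polynomial.C (g l / g j₀))
    rw [map_div₀, hηT, hηT, hεT, hεT, map_mul, map_mul, mul_div_mul_right _ _ hX, hgl]
  refine eq_zero_of_sum_map_C_mul_pow_eq_zero (s := Q.support)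
    (fun n => elimHom Set.univ (fun l => g l / g j₀) j₀ (Q.coeff n)) (hg j₀) ?_
    (Polynomial.mem_support_iff.mpr hm)
  apply map_injective _ (IsFractionRing.injective (Polynomial K) E)
  have h : map η.toRingHom (rename (Prod.map id Subtype.val)
      (Q.eval₂ ψ.toRingHom (C (T' j₀)))) = 0 := by
    rw [hQ, map_zero, map_zero]
  rw [map_zero, ← h, Polynomial.eval₂_eq_sum, Polynomial.sum, map_sum, map_sum, map_sum]
  refine Finset.sum_congr rfl fun n _ => ?_
  rw [← hεT, map_mul, map_mul, map_mul, map_pow, map_pow, map_pow, map_C, rename_C, map_C, ← hη]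
  congr 2
  exact congrArg C (hηT j₀).symm

end Nonvanishing

/-! ### Specializations of the generic ideal and reductions -/

section Specialization

variable {k : Type*} [Field k] {d u ℓ : ℕ} {I : Ideal (MvPolynomial (Fin d) k)} (f : Fin u → I)

theorem specializedIdeal_eq_span (c : Fin ℓ × Fin u → k) :
    specializedIdeal ℓ f c = Ideal.span (Set.range fun i : Fin ℓ =>
      ∑ j, C (c (i, j)) * (f j : MvPolynomial (Fin d) k)) := by
  unfold specializedIdeal genericIdeal
  rw [Ideal.map_span, ← Set.range_comp]
  congr 2
  funext i
  have h : (map (eval c)).comp (map C) = RingHom.id (MvPolynomial (Fin d) k) := by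
    apply MvPolynomial.ringHom_ext <;> simp
  have h' (p : MvPolynomial (Fin d) k) : map (eval c) (map C p) = p := DFunLike.congr_fun h p
  simp [h']

theorem specializedIdeal_le (c : Fin ℓ × Fin u → k) : specializedIdeal ℓ f c ≤ I := by
  rw [specializedIdeal_eq_span, Ideal.span_le]
  rintro _ ⟨i, rfl⟩
  exact sum_mem fun j _ => I.mul_mem_left _ (f j).2

theorem specialFiberClass_sum (c : Fin ℓ × Fin u → k) (i : Fin ℓ)
    (h : ∑ j, C (c (i, j)) * (f j : MvPolynomial (Fin d) k) ∈ I ^ 1) :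
    specialFiberClass 1 h = specialRow (fun j => specialFiberOne I (f j)) c i := by
  let mk : reesAlgebra I →ₐ[k] SpecialFiberRing I :=
    { specialFiberMk I with commutes' := fun _ => rfl }
  have h1 (j : Fin u) : specialFiberOne I (f j) =
      mk ⟨Polynomial.monomial 1 (f j : MvPolynomial (Fin d) k),
        reesAlgebra.monomial_mem.mpr (by simp)⟩ := rfl
  have h2 : specialFiberClass 1 h = mk ⟨_, reesAlgebra.monomial_mem.mpr h⟩ := rfl
  simp only [specialRow, h1, h2, ← map_smul, ← map_sum]
  congr 1
  ext1
  rw [AddSubmonoidClass.coe_finsetSum]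
  simp [Algebra.smul_def, MvPolynomial.algebraMap_eq]

/-- A relation `a ∈ J_c Iⁿ` yields a relation in the special fiber ring. -/
theorem specialFiberClass_mem_span (c : Fin ℓ × Fin u → k) {n : ℕ} {a : MvPolynomial (Fin d) k}
    (ha : a ∈ specializedIdeal ℓ f c * I ^ n) (ha' : a ∈ I ^ (n + 1)) :
    specialFiberClass (n + 1) ha' ∈
      Ideal.span (Set.range (specialRow (fun j => specialFiberOne I (f j)) c)) := by
  set B := Ideal.span (Set.range (specialRow (fun j => specialFiberOne I (f j)) c))
  have h1 : ∀ a ∈ specializedIdeal ℓ f c, ∃ h : a ∈ I ^ 1, specialFiberClass 1 h ∈ B := by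
    intro a ha
    rw [specializedIdeal_eq_span] at ha
    induction ha using Submodule.span_induction with
    | mem x hx =>
      obtain ⟨i, rfl⟩ := hx
      refine ⟨?_, ?_⟩
      · rw [pow_one]
        exact sum_mem fun j _ => I.mul_mem_left _ (f j).2
      · rw [specialFiberClass_sum]
        exact Ideal.subset_span ⟨i, rfl⟩
    | zero =>
      have h0 : (0 : MvPolynomial (Fin d) k) ∈ I ^ 1 := zero_mem _
      have h := specialFiberClass_add h0 h0
      simp only [add_zero, left_eq_add] at h
      exact ⟨h0, h ▸ zero_mem _⟩
    | add x y _ _ hx hy =>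
      obtain ⟨hx, hx'⟩ := hx
      obtain ⟨hy, hy'⟩ := hy
      exact ⟨add_mem hx hy, specialFiberClass_add hx hy ▸ add_mem hx' hy'⟩
    | smul r x _ hx =>
      obtain ⟨hx, hx'⟩ := hx
      have hr : r ∈ I ^ 0 := by simp
      have hrx : r * x ∈ I ^ (0 + 1) := Ideal.mul_mem_left _ _ hx
      have key : specialFiberClass (0 + 1) hrx = _ := specialFiberClass_mul hr hx hrx
      refine ⟨hrx, ?_⟩
      change specialFiberClass (0 + 1) hrx ∈ B
      rw [key]
      exact B.mul_mem_left _ hx'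
  suffices ∃ h : a ∈ I ^ (n + 1), specialFiberClass (n + 1) h ∈ B from this.2
  clear ha'
  induction ha using Submodule.mul_induction_on' with
  | mem_mul_mem x hx y hy =>
    obtain ⟨hx, hx'⟩ := h1 x hx
    have key : ∀ (m : ℕ) (_ : 1 + n = m) (h : x * y ∈ I ^ m),
        specialFiberClass m h = specialFiberClass 1 hx * specialFiberClass n hy := by
      rintro m rfl h
      exact specialFiberClass_mul hx hy h
    refine ⟨?_, ?_⟩
    · rw [pow_succ']
      exact Ideal.mul_mem_mul (by simpa using hx) hy
    · rw [key _ (add_comm _ _)]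
      exact B.mul_mem_right _ hx'
  | add x _ y _ hx hy =>
    obtain ⟨hx, hx'⟩ := hx
    obtain ⟨hy, hy'⟩ := hy
    exact ⟨add_mem hx hy, specialFiberClass_add hx hy ▸ add_mem hx' hy'⟩

/-- A relation in degree `n + 1` of the special fiber ring gives `I ^ (n + 1) = J_c Iⁿ`. Here `ρ`
is the specialization `t ↦ 1` of the embedding into `R[t]`. -/
theorem isIdealReduction_of_pow_le
    (hgen : Ideal.span (Set.range fun j => (f j : MvPolynomial (Fin d) k)) = I)
    {ρ : SpecialFiberRing I →ₐ[k] MvPolynomial (Fin d) k}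
    (hρ : ∀ j, ρ (specialFiberOne I (f j)) = f j) (c : Fin ℓ × Fin u → k) {n : ℕ}
    (h : Submodule.span k (Set.range fun j => specialFiberOne I (f j)) ^ (n + 1) ≤
      Submodule.span k (Set.range (specialRow (fun j => specialFiberOne I (f j)) c)) *
        Submodule.span k (Set.range fun j => specialFiberOne I (f j)) ^ n) :
    IsIdealReduction (specializedIdeal ℓ f c) I := by
  set V := Submodule.span k (Set.range fun j => specialFiberOne I (f j))
  have hpow (m : ℕ) : I ^ m = Ideal.span (ρ '' (V ^ m : Submodule k (SpecialFiberRing I))) := by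
    induction m with
    | zero =>
      rw [pow_zero, Ideal.one_eq_top, eq_comm, Ideal.eq_top_iff_one]
      exact Ideal.subset_span ⟨1, by rw [pow_zero]; exact Submodule.one_le.mp le_rfl, map_one ρ⟩
    | succ m ih =>
      apply le_antisymm
      · rw [pow_succ, ih]
        refine (Ideal.mul_mono_right hgen.ge).trans ?_
        rw [Ideal.span_mul_span', Ideal.span_le]
        rintro _ ⟨_, ⟨x, hx, rfl⟩, _, ⟨j, rfl⟩, rfl⟩
        refine Ideal.subset_span ⟨x * specialFiberOne I (f j), ?_, by simp [hρ]⟩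
        rw [pow_succ]
        exact Submodule.mul_mem_mul hx (Submodule.subset_span ⟨j, rfl⟩)
      · rw [Ideal.span_le]
        rintro _ ⟨x, hx, rfl⟩
        rw [pow_succ] at hx
        induction hx using Submodule.mul_induction_on' with
        | mem_mul_mem x hx y hy =>
          rw [map_mul, pow_succ]
          refine Ideal.mul_mem_mul (ih ▸ Ideal.subset_span ⟨x, hx, rfl⟩) ?_
          have : V ≤ (I.restrictScalars k).comap ρ.toLinearMap := by
            rw [Submodule.span_le]
            rintro _ ⟨j, rfl⟩
            simp [hρ]
          exact this hy
        | add x _ y _ hx hy =>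
          rw [map_add]
          exact add_mem hx hy
  refine ⟨specializedIdeal_le f c, n, le_antisymm ?_ ?_⟩
  · rw [hpow (n + 1), Ideal.span_le]
    rintro _ ⟨x, hx, rfl⟩
    have hx' := h hx
    clear hx
    induction hx' using Submodule.mul_induction_on' with
    | mem_mul_mem x hx y hy =>
      rw [map_mul]
      refine Ideal.mul_mem_mul ?_ (hpow n ▸ Ideal.subset_span ⟨y, hy, rfl⟩)
      have : Submodule.span k (Set.range (specialRow (fun j => specialFiberOne I (f j)) c)) ≤
          ((specializedIdeal ℓ f c).restrictScalars k).comap ρ.toLinearMap := by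
        rw [Submodule.span_le, specializedIdeal_eq_span]
        rintro _ ⟨i, rfl⟩
        refine Ideal.subset_span ⟨i, ?_⟩
        simp [specialRow, hρ, Algebra.smul_def, MvPolynomial.algebraMap_eq]
      exact this hx
    | add x _ y _ hx hy =>
      rw [map_add]
      exact add_mem hx hy
  · rw [pow_succ']
    exact Ideal.mul_mono (specializedIdeal_le f c) le_rfl

/-! ### Monomials in the generic ideal and the saturation -/

/-- Monomials in `x` are units in `K[z]`, and the elimination kills the generators of `J`; so `a *
x ^ w` can lie in `J` only if `a` is eliminated. -/
theorem elimHom_eq_zero_of_monomial_mem (hf : ∀ j, (f j : MvPolynomial (Fin d) k) ≠ 0)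
    {w : Fin d →₀ ℕ} {a : MvPolynomial (Fin ℓ × Fin u) k} (h : monomial w a ∈ genericIdeal ℓ f)
    (j₀ : Fin u) : elimHom Set.univ (fun l =>
      algebraMap (MvPolynomial (Fin d) k) (FractionRing (MvPolynomial (Fin d) k)) (f l) /
      algebraMap (MvPolynomial (Fin d) k) (FractionRing (MvPolynomial (Fin d) k)) (f j₀)) j₀ a
        = 0 := by
  set K := FractionRing (MvPolynomial (Fin d) k)
  have hinj : Function.Injective (algebraMap (MvPolynomial (Fin d) k) K) :=
    IsFractionRing.injective _ _
  set g : Fin u → K := fun l => algebraMap (MvPolynomial (Fin d) k) K (f l)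
  have hg (j : Fin u) : g j ≠ 0 := (map_ne_zero_iff _ hinj).mpr (hf j)
  let φ : MvPolynomial (Fin ℓ × Fin u) k →ₐ[k] MvPolynomial (Fin ℓ × Fin u) K :=
    elimHom Set.univ (fun l => g l / g j₀) j₀
  let Θ : MvPolynomial (Fin d) (MvPolynomial (Fin ℓ × Fin u) k) →+*
      MvPolynomial (Fin ℓ × Fin u) K :=
    eval₂Hom φ.toRingHom fun i => C (algebraMap (MvPolynomial (Fin d) k) K (X i))
  have hΘ : Θ.comp (map C) = C.comp (algebraMap (MvPolynomial (Fin d) k) K) := by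
    apply MvPolynomial.ringHom_ext
    · intro c
      simp only [Θ, RingHom.comp_apply, map_C, eval₂Hom_C]
      change φ (algebraMap k _ c) = C (algebraMap _ K (algebraMap k _ c))
      rw [AlgHom.commutes, ← IsScalarTower.algebraMap_apply]
      rfl
    · intro i
      simp [Θ]
  have hΘ' (p : MvPolynomial (Fin d) k) : Θ (map C p) = C (algebraMap _ K p) :=
    DFunLike.congr_fun hΘ p
  have hker : genericIdeal ℓ f ≤ RingHom.ker Θ := by
    unfold genericIdeal
    rw [Ideal.span_le]
    rintro _ ⟨i, rfl⟩
    have hs := sum_elimValue_mul_eq_zero (Set.mem_univ i) (j₀ := j₀) (y := fun l => g l / g j₀)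
      (w := g) fun l => (mul_div_cancel₀ _ (hg j₀)).symm
    rw [SetLike.mem_coe, RingHom.mem_ker, map_sum, ← hs]
    refine Finset.sum_congr rfl fun j _ => ?_
    rw [map_mul, hΘ']
    simp [Θ, φ, elimHom, g]
  have h' := hker h
  have hmon : (monomial w a : MvPolynomial (Fin d) (MvPolynomial (Fin ℓ × Fin u) k)) =
      C a * map C (monomial w 1) := by
    rw [map_monomial, C_mul_monomial, map_one, mul_one]
  rw [RingHom.mem_ker, hmon, map_mul, hΘ'] at h'
  rcases mul_eq_zero.mp h' with h | h
  · simp only [Θ, eval₂Hom_C] at h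
    exact h
  · simp at h

theorem pow_mul_mem_genericIdeal {ρ : SpecialFiberRing I →ₐ[k] MvPolynomial (Fin d) k}
    (hρ : ∀ j, ρ (specialFiberOne I (f j)) = f j) {a : MvPolynomial (Fin ℓ × Fin u) k} {j : Fin u}
    {n : ℕ} (h : C (specialFiberOne I (f j)) ^ n * map (algebraMap k (SpecialFiberRing I)) a ∈
      genericFiberIdeal ℓ f) :
    map C (f j : MvPolynomial (Fin d) k) ^ n * C a ∈ genericIdeal ℓ f := by
  let Ξ : MvPolynomial (Fin ℓ × Fin u) (SpecialFiberRing I) →+*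
      MvPolynomial (Fin d) (MvPolynomial (Fin ℓ × Fin u) k) :=
    eval₂Hom ((map C).comp ρ.toRingHom) fun p => C (X p)
  have hC (x : SpecialFiberRing I) : Ξ (C x) = map C (ρ x) := by simp [Ξ]
  have hΞ : Ξ.comp (map (algebraMap k (SpecialFiberRing I))) = C := by
    apply MvPolynomial.ringHom_ext
    · intro c
      rw [RingHom.comp_apply, map_C, hC, AlgHom.commutes, MvPolynomial.algebraMap_eq, map_C]
    · intro p
      simp [Ξ]
  have hle : (genericFiberIdeal ℓ f).map Ξ ≤ genericIdeal ℓ f := by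
    unfold genericFiberIdeal
    rw [Ideal.map_span, Ideal.span_le]
    rintro _ ⟨_, ⟨i, rfl⟩, rfl⟩
    refine Ideal.subset_span ⟨i, ?_⟩
    rw [map_sum]
    refine Finset.sum_congr rfl fun j _ => ?_
    rw [map_mul, hC, hρ]
    simp [Ξ]
  have h' := hle (Ideal.mem_map_of_mem Ξ h)
  rwa [map_mul, map_pow, hC, hρ, show Ξ (map (algebraMap k (SpecialFiberRing I)) a) = C a from
    DFunLike.congr_fun hΞ a] at h'

theorem mem_idealSaturation_iff {S : Type*} [CommRing S] {K L : Ideal S} {x : S} :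
    x ∈ idealSaturation K L ↔ ∃ n : ℕ, ∀ p ∈ L ^ n, x * p ∈ K := by
  unfold idealSaturation
  rw [Submodule.mem_iSup_of_directed]
  · simp [Submodule.mem_colon]
  · exact Monotone.directed_le fun m n hmn => Submodule.colon_mono le_rfl (Ideal.pow_le_pow_right hmn)

end Specialization

/-! ### The ideal of non-reductions is principal and prime -/

/-- The kernel of the elimination is principal. It is prime and nonzero; a nonzero element that
does not involve `z_{i₀ j₀}` would lie in the kernel of the elimination for the rows other than
`i₀`, so the transcendence degree of `F` would be at most `ℓ - 1`. -/
theorem ker_elimHom_eq_span {k F K : Type*} {ℓ u : ℕ} [Field k] [Infinite k] [CommRing F]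
    [IsDomain F] [Algebra k F] [Field K] [Algebra k K] {T : Fin u → F} {g : Fin u → K}
    {ε : F →ₐ[k] Polynomial K} (hε : Function.Injective ε) (hg : ∀ j, g j ≠ 0)
    (hT : Algebra.adjoin k (Set.range T) = ⊤)
    (hεT : ∀ j, ε (T j) = Polynomial.C (g j) * Polynomial.X) (j₀ : Fin u)
    (htr : Algebra.trdeg k F = ℓ) :
    ∃ h : MvPolynomial (Fin ℓ × Fin u) k, Irreducible h ∧
      RingHom.ker (elimHom (k := k) (Set.univ : Set (Fin ℓ)) (fun l => g l / g j₀) j₀) =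
        Ideal.span {h} := by
  set φ := elimHom (k := k) (Set.univ : Set (Fin ℓ)) (fun l => g l / g j₀) j₀ with hφ
  obtain ⟨a, ha0, ha⟩ := exists_ne_zero_elimHom_eq_zero (ι := Fin ℓ) hε hg hεT j₀
    (by rw [htr, Fintype.card_fin])
  have hne : RingHom.ker φ ≠ ⊥ := fun h => ha0 (by simpa [h] using (show a ∈ RingHom.ker φ from ha))
  have hprime : (RingHom.ker φ).IsPrime := RingHom.ker_isPrime _
  obtain ⟨h, hmem, hh⟩ := hprime.exists_mem_prime_of_ne_bot hne
  -- Without rows the elimination is the inclusion `k → K`, which is injective.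
  obtain ⟨i₀⟩ : Nonempty (Fin ℓ) := by
    by_contra hemp
    rw [not_nonempty_iff] at hemp
    rw [eq_C_of_isEmpty a] at ha ha0
    have hC : φ (C (coeff 0 a)) = C (algebraMap k K (coeff 0 a)) := φ.commutes _
    rw [hC] at ha
    simp_all
  refine ⟨h, hh.irreducible, ?_⟩
  let E := FractionRing (MvPolynomial (Fin ℓ × Fin u) K)
  have hE : Function.Injective (algebraMap (MvPolynomial (Fin ℓ × Fin u) K) E) :=
    IsFractionRing.injective _ _
  have key := MvPolynomial.ker_eq_span_of_irreducible
    ((algebraMap (MvPolynomial (Fin ℓ × Fin u) K) E).comp φ.toRingHom) (i₀, j₀) (fun p hp => ?_)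
    hh.irreducible (by
      rw [RingHom.comp_apply]
      exact (map_eq_zero_iff _ hE).mpr hmem)
  · rw [← key]
    ext p
    exact (map_eq_zero_iff _ hE).symm
  · have hp' : φ (rename Subtype.val p) = 0 := (map_eq_zero_iff _ hE).mp hp
    -- Without `z_{i₀ j₀}`, the elimination does nothing in row `i₀`.
    have hrow : φ (rename Subtype.val p) =
        elimHom ((Finset.univ.erase i₀ : Finset (Fin ℓ)) : Set (Fin ℓ)) (fun l => g l / g j₀) j₀
          (rename Subtype.val p) := by
      have : φ.comp (rename (Subtype.val : {x // x ≠ (i₀, j₀)} → _)) =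
          (elimHom ((Finset.univ.erase i₀ : Finset (Fin ℓ)) : Set (Fin ℓ))
            (fun l => g l / g j₀) j₀).comp (rename Subtype.val) := by
        ext1 x
        obtain ⟨⟨i, j⟩, hx⟩ := x
        simp only [AlgHom.comp_apply, rename_X, hφ, elimHom, aeval_X]
        by_cases hj : j = j₀
        · subst hj
          have hi : i ≠ i₀ := fun h => hx (by rw [h])
          simp [elimValue, hi]
        · simp [elimValue, hj]
      exact DFunLike.congr_fun this p
    by_contra hp0
    have hle := trdeg_le_of_elimHom_eq_zero hε hg hT hεT
      (fun h0 => hp0 (rename_injective _ Subtype.val_injective (by rw [h0, map_zero])))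
      (hrow ▸ hp')
    rw [htr, Finset.card_erase_of_mem (Finset.mem_univ _), Finset.card_univ, Fintype.card_fin,
      Nat.cast_le] at hle
    have := i₀.pos
    omega

/-- The ideal `(𝓗 : 𝓕₊ ^ ∞) ∩ k[z]` is the kernel of the elimination of any column. -/
theorem mem_nonReductionIdeal_iff {k K : Type*} [Field k] {d u ℓ : ℕ} [Field K] [Algebra k K]
    {I : Ideal (MvPolynomial (Fin d) k)} {f : Fin u → I} [IsDomain (SpecialFiberRing I)]
    (hgen : Ideal.span (Set.range fun j => (f j : MvPolynomial (Fin d) k)) = I) {g : Fin u → K}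
    {ε : SpecialFiberRing I →ₐ[k] Polynomial K} (hε : Function.Injective ε) (hg : ∀ j, g j ≠ 0)
    (hεT : ∀ j, ε (specialFiberOne I (f j)) = Polynomial.C (g j) * Polynomial.X) (j₀ : Fin u)
    (a : MvPolynomial (Fin ℓ × Fin u) k) :
    a ∈ nonReductionIdeal ℓ f ↔ elimHom Set.univ (fun l => g l / g j₀) j₀ a = 0 := by
  have hH : Ideal.span (rowForm (fun j => specialFiberOne I (f j)) '' Set.univ) =
      genericFiberIdeal ℓ f := by
    rw [Set.image_univ]
    rfl
  have hL : (specialFiberPlus I).map (C : _ →+* MvPolynomial (Fin ℓ × Fin u) (SpecialFiberRing I)) =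
      Ideal.span (Set.range fun j => C (specialFiberOne I (f j))) := by
    rw [specialFiberPlus_eq_span f hgen, Ideal.map_span, ← Set.range_comp]
    rfl
  rw [nonReductionIdeal, Ideal.mem_comap, mem_idealSaturation_iff, hL]
  constructor
  · rintro ⟨n, hn⟩
    have hT0 : specialFiberOne I (f j₀) ≠ 0 := by
      intro h
      have := hεT j₀
      rw [h, map_zero] at this
      exact hg j₀ (by simpa using this.symm)
    refine elimHom_eq_zero_of_mul_mem hε hg hεT (pow_ne_zero n hT0) ?_ j₀
    rw [hH, mul_comm, C_pow]
    exact hn _ (Ideal.pow_mem_pow (Ideal.subset_span (Set.mem_range_self j₀)) n)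
  · intro ha
    let Q : Ideal (MvPolynomial (Fin ℓ × Fin u) (SpecialFiberRing I)) :=
      (genericFiberIdeal ℓ f).colon {map (algebraMap k (SpecialFiberRing I)) a}
    have hQ {p} : p ∈ Q ↔ p * map (algebraMap k (SpecialFiberRing I)) a ∈ genericFiberIdeal ℓ f := by
      simp [Q, Submodule.mem_colon]
    obtain ⟨n, hn⟩ := Ideal.exists_pow_le_of_le_radical_of_fg (J := Q)
      (I := Ideal.span (Set.range fun j => C (specialFiberOne I (f j)))) (by
        rw [Ideal.span_le]
        rintro _ ⟨j, rfl⟩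
        obtain ⟨n, hn⟩ := exists_pow_mul_mem_of_elimHom_eq_zero hε hg hεT
          (elimHom_eq_zero_of_elimHom_eq_zero hε hg hεT ha j)
        exact ⟨n, hQ.mpr (hH ▸ hn)⟩) (Submodule.fg_span (Set.finite_range _))
    exact ⟨n, fun p hp => mul_comm p _ ▸ hQ.mp (hn hp)⟩

theorem theorem5p6 {k : Type*} [Field k] [Infinite k] {d u : ℕ} (δ ℓ : ℕ)
    (I : Ideal (MvPolynomial (Fin d) k)) (hI : I ≠ ⊥) (f : Fin u → I)
    (hgen : Ideal.span (Set.range fun j => (f j : MvPolynomial (Fin d) k)) = I)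
    (hmon : ∀ j, ∃ a : Fin d →₀ ℕ, a.degree = δ ∧
      (f j : MvPolynomial (Fin d) k) = MvPolynomial.monomial a 1)
    (hℓ : analyticSpread I = (ℓ : WithBot ℕ∞)) :
    (∃ (r : ℕ) (v : Fin r → Fin d →₀ ℕ) (K : Fin r → Ideal (MvPolynomial (Fin ℓ × Fin u) k)),
      IsMonomialDecomposition (monoIdeal (genericIdeal ℓ f)) v K) ∧
    ∃ h : MvPolynomial (Fin ℓ × Fin u) k,
      Irreducible h ∧
      nonReductionIdeal ℓ f = Ideal.span {h} ∧
      (∀ c : Fin ℓ × Fin u → k,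
        MvPolynomial.eval c h = 0 ↔ ¬ IsIdealReduction (specializedIdeal ℓ f c) I) ∧
      ∀ (r : ℕ) (v : Fin r → Fin d →₀ ℕ) (K : Fin r → Ideal (MvPolynomial (Fin ℓ × Fin u) k)),
        IsMonomialDecomposition (monoIdeal (genericIdeal ℓ f)) v K →
          ⨆ i, K i = Ideal.span {h} := by
  refine ⟨exists_isMonomialDecomposition _, ?_⟩
  let K := FractionRing (MvPolynomial (Fin d) k)
  have hK : Function.Injective (algebraMap (MvPolynomial (Fin d) k) K) :=
    IsFractionRing.injective _ _
  have hf (j : Fin u) : (f j : MvPolynomial (Fin d) k) ≠ 0 := by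
    obtain ⟨a, -, ha⟩ := hmon j
    simp [ha]
  obtain ⟨j₀⟩ : Nonempty (Fin u) := by
    by_contra h
    rw [not_nonempty_iff] at h
    exact hI (by rw [← hgen]; simp)
  obtain ⟨ε₀, hε₀, hε₀T⟩ := exists_specialFiber_embedding f hgen (δ := δ) fun j => by
    obtain ⟨a, ha, hfa⟩ := hmon j
    rw [hfa]
    exact isHomogeneous_monomial _ ha
  have : IsDomain (SpecialFiberRing I) := hε₀.isDomain ε₀.toRingHom
  let T (j : Fin u) : SpecialFiberRing I := specialFiberOne I (f j)
  have hT : Algebra.adjoin k (Set.range T) = ⊤ := adjoin_range_specialFiberOne f hgen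
  let g (j : Fin u) : K := algebraMap (MvPolynomial (Fin d) k) K (f j)
  have hg (j : Fin u) : g j ≠ 0 := (map_ne_zero_iff _ hK).mpr (hf j)
  let ε : SpecialFiberRing I →ₐ[k] Polynomial K :=
    (Polynomial.mapAlgHom (IsScalarTower.toAlgHom k (MvPolynomial (Fin d) k) K)).comp ε₀
  have hε : Function.Injective ε := (Polynomial.map_injective _ hK).comp hε₀
  have hεT (j : Fin u) : ε (T j) = Polynomial.C (g j) * Polynomial.X := by
    simp [ε, T, g, hε₀T]
  let ρ : SpecialFiberRing I →ₐ[k] MvPolynomial (Fin d) k :=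
    ((Polynomial.aeval (1 : MvPolynomial (Fin d) k)).restrictScalars k).comp ε₀
  have hρ (j : Fin u) : ρ (T j) = f j := by
    simp [ρ, T, hε₀T]
  have hft : Algebra.FiniteType k (SpecialFiberRing I) :=
    ⟨Subalgebra.fg_def.mpr ⟨_, Set.finite_range T, hT⟩⟩
  obtain ⟨h, hirr, hker⟩ := ker_elimHom_eq_span (ℓ := ℓ) hε hg hT hεT j₀
    (trdeg_eq_of_ringKrullDim_eq k hℓ)
  have hmem (a : MvPolynomial (Fin ℓ × Fin u) k) :
      elimHom Set.univ (fun l => g l / g j₀) j₀ a = 0 ↔ h ∣ a := by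
    rw [← Ideal.mem_span_singleton, ← hker, RingHom.mem_ker]
  refine ⟨h, hirr, ?_, fun c => ⟨?_, ?_⟩, fun r v C' hC' => hC'.iSup_eq fun a => ?_⟩
  · ext a
    rw [mem_nonReductionIdeal_iff hgen hε hg hεT j₀, hmem, Ideal.mem_span_singleton]
  · rintro hc ⟨-, n, hn⟩
    obtain ⟨a, hac, ha⟩ := exists_eval_eq_one_of_pow_le (T := T) (c := c) (n := n) fun x hx => by
      refine mem_mul_pow_of_mem_span hε hT hεT ?_ hx ?_
      · rw [Submodule.span_le]
        rintro _ ⟨i, rfl⟩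
        exact sum_mem fun j _ => Submodule.smul_mem _ _ (Submodule.subset_span ⟨j, rfl⟩)
      · obtain ⟨b, hb, rfl⟩ := exists_specialFiberClass_eq f (n + 1) hx
        exact Ideal.span_mono Submodule.subset_span (specialFiberClass_mem_span f c (hn ▸ hb) hb)
    have hTne : T j₀ ≠ 0 := fun h0 => hf j₀ (by rw [← hρ, h0, map_zero])
    have ha0 := elimHom_eq_zero_of_mul_mem hε hg hεT (S := Set.univ) (pow_ne_zero (n + 1) hTne)
      (Set.image_univ ▸ ha _ (Submodule.pow_mem_pow _ (Submodule.subset_span (Set.mem_range_self j₀)) _)) j₀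
    obtain ⟨b, rfl⟩ := (hmem a).mp ha0
    rw [map_mul, hc, zero_mul] at hac
    exact zero_ne_one hac
  · intro hred
    by_contra hc
    obtain ⟨n, hn⟩ := exists_pow_le_of_eval_ne_zero hε hg hT hεT
      (elimHom_eq_zero_of_elimHom_eq_zero hε hg hεT ((hmem h).mpr dvd_rfl)) hc
    rw [Set.image_univ] at hn
    exact hred (isIdealReduction_of_pow_le f hgen hρ c hn)
  · rw [Ideal.mem_span_singleton, ← hmem]
    constructor
    · intro ha
      obtain ⟨n, hn⟩ := exists_pow_mul_mem_of_elimHom_eq_zero hε hg hεT ha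
      rw [Set.image_univ] at hn
      have hJ := pow_mul_mem_genericIdeal f hρ hn
      obtain ⟨w, -, hw⟩ := hmon j₀
      refine ⟨n • w, ?_⟩
      rw [hw, map_monomial, monomial_pow, mul_comm, C_mul_monomial] at hJ
      simpa using hJ
    · rintro ⟨w, hw⟩
      exact elimHom_eq_zero_of_monomial_mem f hf hw j₀
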